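/- Theorem 13. Notation and conventions. For $S,T\subseteq\omega_1$ write $\tilde S\le\tilde T$ if $S\cap C\subseteq T\cap C$ for some closed unbounded set (cub) $C\subseteq\omega_1$, and $\tilde S=0$ if $S\cap C=\emptyset$ for some cub $C$. In a poset $\mathbb P$ a larger element is a stronger condition: $D\subseteq\mathbb P$ is dense if every $p\in\mathbb P$ lies below some $d\in D$, and for a family $\mathcal D$ of dense sets a $\mathcal D$-generic set is a nonempty, downward closed, (upward) directed $G\subseteq\mathbb P$ that meets every member of $\mathcal D$. Let $\kappa$ range over the regular cardinals that are large enough for $\mathbb P$ (the power set of $\mathbb P$ belongs to $H(\kappa)$, the collection of all sets hereditarily of cardinality $<\kappa$). An element $p\in\mathbb P$ is $N$-generic if for every dense $D\in N$ the set $D\cap N$ is predense above $p$ (each $q\ge p$ is compatible with some element of $D\cap N$). $\mathbb P$ is proper if there is a cub $\mathcal C$, in the countable subsets of $H(\kappa)$, of countable $N\prec(H(\kappa),\in)$ such that for each $N\in\mathcal C$ every $p\in\mathbb P\cap N$ lies below an $N$-generic element. For $T\subseteq\omega_1$, $\mathbb P$ is $T$-complete if there is a cub $\mathcal C$ of countable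 $N\prec (H(\kappa),\in)$ such that for each $N\in\mathcal C$ with $N\cap\omega_1\in T$, every chain $p_0\le p_1\le\cdots$ in $\mathbb P\cap N$ that meets every dense $D\in N$ has an upper bound in $\mathbb P$. Assume Ax($S$), that is, let $S\subseteq\omega_1$ be a stationary and co-stationary set such that for every proper $(\omega_1\setminus S)$-complete poset $\mathbb P$ of cardinality $\aleph_1$ and every family $\mathcal D$ of $\aleph_1$ dense subsets of $\mathbb P$ there is a $\mathcal D$-generic subset of $\mathbb P$. Let $R$ be a valuation domain of cardinality $\aleph_1$ with quotient field $Q$ and group of units $R^*$, let $A\subseteq J$ be $R$-submodules of $Q$, and let $J=\bigcup_{\nu<\omega_1}r_\nu^{-1}R$ with nonzero $r_\nu\in R$ such that $r_\mu\mid r_\nu$ for $\mu<\nu$. Congruences modulo $r_\sigma A$ are between elements of $R$, i.e. modulo the ideal $r_\sigma A\cap R$. For $\delta<\omega_1$ let $\mathcal T^\delta$ be the set of sequences $\langle u_\sigma:\sigma<\delta\rangle$ of units of $R$ with $u_\tau-u_\sigma\in r_\sigma A$ for all $\sigma<\tau<\delta$, and let $\mathcal L^\delta$ be the set of those for which there is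 $u_\delta\in R^*$ with $u_\delta-u_\sigma\in r_\sigma A$ for all $\sigma<\delta$. Let $\{N_\alpha:\alpha<\omega_1\}$ be an $\omega_1$-filtration of $R$ by subrings: an increasing chain of countable subrings with union $R$, such that $N_\alpha=\bigcup_{\beta<\alpha}N_\beta$ for limit $\alpha$ and, for all $\alpha$, $R^*\cap N_\alpha=N_\alpha^*$ and $r_\nu\in N_\alpha\Leftrightarrow\nu<\alpha$. Let $\mathcal T^\delta(N_\delta)$ be the set of sequences of cosets $\langle u_\sigma+r_\sigma A:\sigma<\delta\rangle$ with $u\in\mathcal T^\delta$ and all $u_\sigma\in N_\delta$, topologized by the basic sets $[u]_\nu$ ($\nu<\delta$) of those sequences that agree with $u$ at all $\sigma\le\nu$; let $\mathcal L^\delta(N_\delta)$ consist of those members for which $u\in\mathcal L^\delta$. Suppose that (1) $\Gamma_R(J/A)\le\tilde S$, where $\Gamma_R(J/A)$ is the class of the set of limit ordinals $\delta<\omega_1$ such that $R/\bigcap_{\nu<\delta}r_\nu A$ is not complete in the linear topology with basis $r_\nu A$ $(\nu<\delta)$ of neighbourhoods of $0$; (2) $\Gamma'_R(J/A)=0$,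 where $\Gamma'_R(J/A)$ is the class of the set of limit ordinals $\delta<\omega_1$ for which there is $u\in\mathcal T^\delta$ such that for every $f\in\mathcal L^\delta$ there is $\sigma<\delta$ with $u_\sigma f_\sigma\notin N_\delta$; (&) for every $\delta\in S$ and every nonempty open subset $V$ of $\mathcal T^\delta(N_\delta)$, the set $V\cap\mathcal L^\delta(N_\delta)$ is non-meager in $\mathcal T^\delta(N_\delta)$. Then every uniserial $R$-module $U$ of type $J/A$ is standard. Here $U$ is uniserial if its submodules are totally ordered by inclusion; $U$ is of type $J/A$ if $J/A\cong D(a)/\mathrm{Ann}(a)$ for some nonzero $a\in U$, where $D(a)=\bigcup\{r^{-1}R: r\in R\text{ divides }a\text{ in }U\}\subseteq Q$; and $U$ is standard if it is isomorphic to $J'/A'$ for some $R$-submodules $A'\subseteq J'$ of $Q$. -/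

import Mathlib

open scoped Cardinal Ordinal

namespace Uniserial

/-! ### Countable ordinals and subsets of `ω₁` modulo the club filter -/

/-- The well-ordered set `ω₁` of all countable ordinals. -/
abbrev W : Type 1 := Set.Iio (ω₁ : Ordinal.{0})

/-- `S̃ ≤ T̃`: there is a cub `C` with `S ∩ C ⊆ T ∩ C`. -/
def LeModClub (S T : Set W) : Prop :=
  ∃ C : Set W, IsClub C ∧ S ∩ C ⊆ T ∩ C

/-- `S̃ = T̃`: there is a cub `C` with `S ∩ C = T ∩ C`. -/
def EqModClub (S T : Set W) : Prop :=
  ∃ C : Set W, IsClub C ∧ S ∩ C = T ∩ C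

/-! ### Countable elementary submodels of `H(κ)` -/

/-- `H(κ)`: the sets that are hereditarily of cardinality `< κ` (used for regular `κ` only). -/
def H (κ : Cardinal.{0}) : Set ZFSet.{0} :=
  {x | x.Hereditarily fun y => y.card < κ}

/-- The only non-logical symbol of the language of set theory. -/
inductive SetRel : ℕ → Type
  | mem : SetRel 2

/-- The first-order language of set theory. -/
def setLanguage : FirstOrder.Language := ⟨fun _ => Empty, SetRel⟩

/-- A collection `X` of sets as the structure `(X, ∈)`. -/
instance setStructure (X : Set ZFSet.{0}) : setLanguage.Structure X where
  funMap f := f.elim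
  RelMap
    | .mem => fun x => (x 0 : ZFSet.{0}) ∈ (x 1 : ZFSet.{0})

/-- `N ≺ (X, ∈)`. -/
def IsElementarySubmodel (X N : Set ZFSet.{0}) : Prop :=
  ∃ M : setLanguage.ElementarySubstructure X, N = Subtype.val '' (M : Set X)

/-- `C` is a cub in `[X]^ω`, the collection of countable subsets of `X`. -/
structure IsClubOfCountable {α : Type*} (X : Set α) (C : Set (Set α)) : Prop where
  subset : ∀ N ∈ C, N ⊆ X
  countable : ∀ N ∈ C, N.Countable
  unbounded : ∀ M : Set α, M ⊆ X → M.Countable → ∃ N ∈ C, M ⊆ N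
  closed : ∀ f : ℕ → Set α, Monotone f → (∀ n, f n ∈ C) → (⋃ n, f n) ∈ C

/-- `C` is a cub of countable elementary submodels of `H(κ)`. -/
def IsClubOfSubmodels (κ : Cardinal.{0}) (C : Set (Set ZFSet.{0})) : Prop :=
  IsClubOfCountable (H κ) C ∧ ∀ N ∈ C, IsElementarySubmodel (H κ) N

/-- `N ∩ ω₁ = δ`, the members of `ω₁` being von Neumann ordinals. -/
def TraceEq (N : Set ZFSet.{0}) (δ : W) : Prop :=
  ∀ α : W, α.1.toZFSet ∈ N ↔ α < δ

/-! ### Posets, properness, completeness and the axiom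

A larger element of a poset is a stronger condition. -/

/-- A poset whose underlying set is a set of `ZFC`. -/
structure SetPoset where
  /-- the underlying set -/
  carrier : ZFSet.{0}
  /-- the ordering: `le p q` says that `q` extends `p` -/
  le : carrier → carrier → Prop
  le_refl : ∀ p, le p p
  le_trans : ∀ p q s, le p q → le q s → le p s
  le_antisymm : ∀ p q, le p q → le q p → p = q

namespace SetPoset

variable (P : SetPoset)

/-- `D` is a dense subset of `P`. -/
def IsDense (D : Set P.carrier) : Prop :=
  ∀ p, ∃ d ∈ D, P.le p d

/-- The set `D` of `ZFC` is a dense subset of `P`. -/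
def IsDenseSet (D : ZFSet.{0}) : Prop :=
  D ⊆ P.carrier ∧ P.IsDense {d | (d : ZFSet.{0}) ∈ D}

/-- `κ` is large enough for `P`: it is regular and the power set of `P` belongs to `H(κ)`. -/
def IsLargeEnough (κ : Cardinal.{0}) : Prop :=
  κ.IsRegular ∧ P.carrier.powerset ∈ H κ

/-- `p` is `N`-generic: for each dense subset `D` of `P` with `D ∈ N`, the set `D ∩ N` is predense
above `p`. -/
def IsNGeneric (N : Set ZFSet.{0}) (p : P.carrier) : Prop :=
  ∀ D ∈ N, P.IsDenseSet D → ∀ q, P.le p q →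
    ∃ d : P.carrier, (d : ZFSet.{0}) ∈ D ∧ (d : ZFSet.{0}) ∈ N ∧ ∃ s, P.le q s ∧ P.le d s

/-- `P` is proper. -/
def IsProper : Prop :=
  ∀ κ, P.IsLargeEnough κ → ∃ C, IsClubOfSubmodels κ C ∧
    ∀ N ∈ C, ∀ p : P.carrier, (p : ZFSet.{0}) ∈ N → ∃ q, P.le p q ∧ P.IsNGeneric N q

/-- `P` is `T`-complete: for a cub of countable `N ≺ H(κ)`, if `N ∩ ω₁ ∈ T` then every increasing
`ω`-chain in `P ∩ N` that meets each dense subset of `P` belonging to `N` has an upper bound. -/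
def IsCompleteFor (T : Set W) : Prop :=
  ∀ κ, P.IsLargeEnough κ → ∃ C, IsClubOfSubmodels κ C ∧
    ∀ N ∈ C, ∀ δ ∈ T, TraceEq N δ →
      ∀ p : ℕ → P.carrier, (∀ n, P.le (p n) (p (n + 1))) → (∀ n, (p n : ZFSet.{0}) ∈ N) →
        (∀ D ∈ N, P.IsDenseSet D → ∃ n, (p n : ZFSet.{0}) ∈ D) → ∃ q, ∀ n, P.le (p n) q

/-- `G` is a generic subset of `P` for the family `D`: a directed, downward closed, nonempty set
that meets every `D ν`. -/
structure IsGeneric {ι : Type*} (D : ι → Set P.carrier) (G : Set P.carrier) : Prop where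
  nonempty : G.Nonempty
  directed : ∀ p ∈ G, ∀ q ∈ G, ∃ s ∈ G, P.le p s ∧ P.le q s
  downward : ∀ p q, P.le p q → q ∈ G → p ∈ G
  meets : ∀ i, ∃ p ∈ G, p ∈ D i

end SetPoset

/-- The set `S` is as asserted to exist by Ax(S): it is stationary and co-stationary, and for every
proper `(ω₁ ∖ S)`-complete poset `P` of cardinality `ℵ₁` and every family of `ℵ₁` dense subsets of
`P` there is a generic subset of `P`. -/
def AxiomS (S : Set W) : Prop :=
  IsStationary S ∧ IsStationary Sᶜ ∧
    ∀ P : SetPoset, P.carrier.card = ℵ₁ → P.IsProper → P.IsCompleteFor Sᶜ →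
      ∀ D : W → Set P.carrier, (∀ ν, P.IsDense (D ν)) → ∃ G, P.IsGeneric D G

/-! ### Uniserial modules and their types -/

section Modules

variable (R : Type*) [CommRing R] (Q : Type*) [Field Q] [Algebra R Q]
variable (U : Type*) [AddCommGroup U] [Module R U]

/-- The submodules of `U` are totally ordered by inclusion. -/
def IsUniserial : Prop :=
  ∀ X Y : Submodule R U, X ≤ Y ∨ Y ≤ X

/-- `U` is isomorphic to `J / A` for some `R`-submodules `A ⊆ J` of `Q`. -/
def IsStandard : Prop :=
  ∃ J A : Submodule R Q, A ≤ J ∧ Nonempty (U ≃ₗ[R] (J ⧸ A.submoduleOf J))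

variable {U}

/-- `D(a)`, the union of the chain of the `r⁻¹ R` over all `r` that divide `a` in `U`. -/
def divisorModule (a : U) : Submodule R Q :=
  ⨆ r ∈ {r : R | ∃ x : U, r • x = a}, Submodule.span R {(algebraMap R Q r)⁻¹}

/-- `Ann(a)` as an `R`-submodule of `Q`. -/
def annModule (a : U) : Submodule R Q :=
  IsLocalization.coeSubmodule Q (Ideal.torsionOf R U a)

variable {R Q} (U)

/-- `U` is of type `J / A`: `J / A ≅ D(a) / Ann(a)` for some nonzero `a ∈ U`. -/
def HasType (J A : Submodule R Q) : Prop :=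
  ∃ a : U, a ≠ 0 ∧ Nonempty ((J ⧸ A.submoduleOf J) ≃ₗ[R]
    (divisorModule R Q a ⧸ (annModule R Q a).submoduleOf (divisorModule R Q a)))

end Modules

/-! ### The Gamma invariants -/

section Gamma

variable {R : Type*} [CommRing R] {Q : Type*} [Field Q] [Algebra R Q]

/-- `J = ⋃_ν r_ν⁻¹ R`, where the `r_ν` are nonzero and `r_μ` divides `r_ν` for `μ < ν < ω₁`. -/
structure Generates (r : W → R) (J : Submodule R Q) : Prop where
  ne_zero : ∀ ν, r ν ≠ 0
  dvd : ∀ μ ν, μ < ν → r μ ∣ r ν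
  eq_iUnion : (J : Set Q) = ⋃ ν, {q | ∃ s : R, q = (algebraMap R Q (r ν))⁻¹ * algebraMap R Q s}

/-- The ideal `r A ∩ R` of `R` (which is `r A` as soon as `r A ⊆ R`). -/
def scaled (A : Submodule R Q) (r : R) : Ideal R :=
  (A.map (LinearMap.lsmul R Q r)).comap (Algebra.linearMap R Q)

/-- Every Cauchy sequence converges in the linear topology of the ring `M` for which the ideals
`B i` are a basis of neighbourhoods of `0` (the topology being metrizable where this is used). -/
def IsCompleteLinear {M : Type*} [CommRing M] {ι : Type*} (B : ι → Ideal M) : Prop :=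
  ∀ x : ℕ → M, (∀ i, ∃ n, ∀ k ≥ n, ∀ l ≥ n, x k - x l ∈ B i) →
    ∃ y, ∀ i, ∃ n, ∀ k ≥ n, x k - y ∈ B i

/-- The ideal `⋂_{ν < δ} r_ν A = (A : J_δ)`, where `J_δ = ⋃_{ν < δ} r_ν⁻¹ R`. -/
def colonIdeal (A : Submodule R Q) (r : W → R) (δ : W) : Ideal R :=
  ⨅ ν : Set.Iio δ, scaled A (r ν)

/-- The set of limit ordinals `δ < ω₁` such that `R / (A : J_δ)` is not complete in the topology
with basis `r_ν A` (`ν < δ`). Its class modulo the club filter is `Γ_R(J/A)`. -/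
def gammaSet (A : Submodule R Q) (r : W → R) : Set W :=
  {δ | Order.IsSuccLimit δ ∧ ¬ IsCompleteLinear fun ν : Set.Iio δ =>
    (scaled A (r ν)).map (Ideal.Quotient.mk (colonIdeal A r δ))}

/-- `𝒯^δ`: the sequences of units `u_σ` (`σ < δ`) with `u_τ - u_σ ∈ r_σ A` for `σ < τ < δ`. -/
def cauchyUnits (A : Submodule R Q) (r : W → R) (δ : W) : Set (Set.Iio δ → Rˣ) :=
  {u | ∀ σ τ : Set.Iio δ, σ < τ → (u τ : R) - u σ ∈ scaled A (r σ)}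

/-- `ℒ^δ`: the members of `𝒯^δ` that have a limit. -/
def convergentUnits (A : Submodule R Q) (r : W → R) (δ : W) : Set (Set.Iio δ → Rˣ) :=
  {u | u ∈ cauchyUnits A r δ ∧ ∃ l : Rˣ, ∀ σ : Set.Iio δ, (l : R) - u σ ∈ scaled A (r σ)}

/-- `N` is an `ω₁`-filtration of `R` by subrings, relative to the sequence `r`. -/
structure IsFiltration (r : W → R) (N : W → Subring R) : Prop where
  countable : ∀ α, (N α : Set R).Countable
  mono : Monotone N
  exhaustive : ∀ x, ∃ α, x ∈ N α
  continuous : ∀ α, Order.IsSuccLimit α → ∀ x ∈ N α, ∃ β < α, x ∈ N β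
  units : ∀ α, ∀ x ∈ N α, IsUnit x → ∃ y ∈ N α, x * y = 1
  mem_iff : ∀ ν α, r ν ∈ N α ↔ ν < α

/-- The set `E'` whose class modulo the club filter is `Γ'_R(J/A)`. -/
def gammaPrimeSet (A : Submodule R Q) (r : W → R) (N : W → Subring R) : Set W :=
  {δ | Order.IsSuccLimit δ ∧ ∃ u ∈ cauchyUnits A r δ, ∀ f ∈ convergentUnits A r δ,
    ∃ σ, (u σ : R) * f σ ∉ N δ}

/-! ### The trees `𝒯^δ(N)` -/

/-- `𝒯^δ(N)`: the sequences of cosets `u_σ + r_σ A` (`σ < δ`) of sequences `u ∈ 𝒯^δ` all of whose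
terms belong to `N`. -/
def Tree (A : Submodule R Q) (r : W → R) (N : Subring R) (δ : W) : Type _ :=
  {v : (σ : Set.Iio δ) → R ⧸ scaled A (r σ) // ∃ u ∈ cauchyUnits A r δ,
    (∀ σ, (u σ : R) ∈ N) ∧ ∀ σ, v σ = Ideal.Quotient.mk _ (u σ : R)}

/-- The tree topology, generated by the sets `[u]_ν = {v | v_σ = u_σ for all σ ≤ ν}`. -/
instance treeTopology (A : Submodule R Q) (r : W → R) (N : Subring R) (δ : W) :
    TopologicalSpace (Tree A r N δ) :=
  TopologicalSpace.generateFrom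
    {B | ∃ (u : Tree A r N δ) (ν : Set.Iio δ), B = {v | ∀ σ ≤ ν, v.1 σ = u.1 σ}}

/-- `ℒ^δ(N)`: the members of `𝒯^δ(N)` that come from sequences in `ℒ^δ`. -/
def convergentBranches (A : Submodule R Q) (r : W → R) (N : Subring R) (δ : W) :
    Set (Tree A r N δ) :=
  {v | ∃ u ∈ convergentUnits A r δ, ∀ σ, v.1 σ = Ideal.Quotient.mk _ (u σ : R)}

end Gamma

end Uniserial

namespace Uniserial

/-! ### Countable ordinals -/

/-! Choose generators `a ν` of `U` that behave like `r_ν⁻¹`: their annihilators are the ideals `r_ν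
A ∩ R`, and for `σ ≤ τ` the element `a σ` is a unit `E σ τ` times `(r_τ / r_σ) a τ`. Comparing three
indices shows that `E` is a cocycle modulo these ideals. If units `c σ` satisfy `c σ * E σ τ ≡ c τ`
modulo `r_σ A`, then the elements `c ν • a ν` are coherent without correction factors, and `r_ν⁻¹ s
↦ s c_ν a_ν` induces `J / A ≅ U`. So it suffices to trivialize the cocycle.

The units `c σ` come from forcing. A condition is a pair `(σ, c)`: the unit at the top height `σ`
already determines the values below it modulo the ideals, as `c * (E ρ σ)⁻¹`. This makes the order
tree-like and keeps the number of conditions at `ℵ₁`. Genericity for the `ℵ₁` height sets yields a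
full solution, so what remains is properness and completeness off `S`. Let a countable elementary
submodel have trace `δ` on `ω₁`.

If `δ ∉ S`, then on a cub completeness at `δ` holds. A chain with heights cofinal in `δ`, pushed up
to height `δ`, is a Cauchy sequence, and its limit gives an upper bound
(`exists_limit_of_complete`). Enumerating the dense sets of the submodel turns this into a generic
condition.

If `δ ∈ S`, then `Γ' = 0` supplies a branch of partial solutions with values in `N_δ` that has a
limit at `δ` (`exists_convergent_branch`). Multiplication by it identifies the tree `𝒯^δ(N_δ)` with
the tree of branches of conditions in the submodel, and dense sets of conditions become dense open
sets. By (&) some convergent branch meets all of them, and its limit is a generic condition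
(`exists_generic_of_nonmeagre`). -/

theorem mk_W : #W = Cardinal.lift.{1} (ℵ₁ : Cardinal.{0}) := by
  simp [W, Cardinal.mk_Iio_ordinal]

theorem countable_Iio (δ : W) : (Set.Iio δ).Countable := by
  have : (Set.Iio δ.1).Countable := by
    rw [← Cardinal.le_aleph0_iff_set_countable, Cardinal.mk_Iio_ordinal]
    have h : δ.1.card < ℵ₁ := Cardinal.lt_ord.1 (by rw [Cardinal.ord_aleph]; exact δ.2)
    rw [← Cardinal.succ_aleph0, Order.lt_succ_iff] at h
    exact Cardinal.lift_le_aleph0.2 h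
  exact (this.preimage Subtype.val_injective).mono fun x hx => hx

instance (δ : W) : Countable (Set.Iio δ) := countable_Iio δ

theorem exists_forall_lt {s : Set W} (hs : s.Countable) : ∃ β, ∀ α ∈ s, α < β := by
  have := hs.to_subtype
  have h : ⨆ a : s, Order.succ a.1.1 < ω₁ :=
    Ordinal.iSup_lt_omega_one fun a => (Cardinal.isSuccLimit_omega 1).succ_lt a.1.2
  refine ⟨⟨_, h⟩, fun α hα => ?_⟩
  rw [← Subtype.coe_lt_coe, ← Order.succ_le_iff]
  exact Ordinal.le_iSup (fun a : s => Order.succ a.1.1) ⟨α, hα⟩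

theorem exists_gt' (a : W) : ∃ b, a < b :=
  (exists_forall_lt (Set.countable_singleton a)).imp fun _ h => h a rfl

/-- This is what makes the intersection of two cubs a cub. -/
theorem cof_W_ne : Order.cof W ≠ ℵ₀ := by
  rw [Ordinal.cof_Iio, ← Ordinal.lift_cof, Cardinal.cof_omega_one]
  simpa using Cardinal.aleph0_lt_aleph_one.ne'

theorem exists_isLUB {s : Set W} (hs : s.Countable) : ∃ a, IsLUB s a := by
  obtain ⟨β, hβ⟩ := exists_forall_lt hs
  have hne : (upperBounds s).Nonempty := ⟨β, fun x hx => (hβ x hx).le⟩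
  exact ⟨wellFounded_lt.min _ hne, wellFounded_lt.min_mem _ hne,
    fun x hx => wellFounded_lt.min_le hx⟩

theorem isSuccLimit_of_forall {δ a : W} (h : a < δ) (hδ : ∀ β < δ, ∃ γ, β < γ ∧ γ < δ) :
    Order.IsSuccLimit δ :=
  ⟨fun hm => hm.not_lt h, fun β hβ => by
    obtain ⟨γ, h1, h2⟩ := hδ β hβ.lt
    exact hβ.2 h1 h2⟩

theorem _root_.Order.IsSuccLimit.exists_between {δ : W} (hδ : Order.IsSuccLimit δ) {β : W}
    (h : β < δ) : ∃ γ, β < γ ∧ γ < δ := by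
  have := hδ.2 β
  contrapose! this
  exact ⟨h, fun c hc => not_lt.2 (this c hc)⟩

/-- For unboundedness, iterate `ω` times a function that bounds all earlier values of `h`; the
supremum is a closure point. -/
theorem isClub_closed (h : W → Set W) (hc : ∀ β, (h β).Countable) :
    IsClub {δ : W | Order.IsSuccLimit δ ∧ ∀ β < δ, ∀ γ ∈ h β, γ < δ} := by
  constructor
  · intro d hd ⟨x₀, hx₀⟩ _ a ha
    refine ⟨?_, fun β hβ γ hγ => ?_⟩
    · obtain ⟨y, hy⟩ := not_isMin_iff.1 (hd hx₀).1.1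
      refine isSuccLimit_of_forall (hy.trans_le (ha.1 hx₀)) fun β hβ => ?_
      obtain ⟨x, hx, hβx⟩ := (lt_isLUB_iff ha).1 hβ
      obtain ⟨γ, h1, h2⟩ := (hd hx).1.exists_between hβx
      exact ⟨γ, h1, h2.trans_le (ha.1 hx)⟩
    · obtain ⟨x, hx, hβx⟩ := (lt_isLUB_iff ha).1 hβ
      exact ((hd hx).2 β hβx γ hγ).trans_le (ha.1 hx)
  · intro a
    have hg : ∀ β, ∃ b, β < b ∧ ∀ α < b, α ≤ β → ∀ γ ∈ h α, γ < b := by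
      intro β
      obtain ⟨b, hb⟩ := exists_forall_lt (s := insert β (⋃ α ∈ Set.Iio β, h α ∪ h β))
        (((countable_Iio β).biUnion fun α _ => (hc α).union (hc β)).insert β)
      obtain ⟨b', hb'⟩ := exists_forall_lt ((hc β).insert b)
      have hbb := hb' b (Set.mem_insert _ _)
      refine ⟨b', (hb β (Set.mem_insert _ _)).trans hbb, fun α _ hα γ hγ => ?_⟩
      rcases hα.lt_or_eq with hα | rfl
      · refine (hb γ (Set.mem_insert_of_mem _ ?_)).trans hbb
        simp only [Set.mem_iUnion]
        exact ⟨α, hα, Or.inl hγ⟩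
      · exact hb' γ (Set.mem_insert_of_mem _ hγ)
    choose g hg1 hg2 using hg
    obtain ⟨δ, hδ⟩ := exists_isLUB (Set.countable_range fun n => g^[n] a)
    have hlt : ∀ n, g^[n] a < δ := fun n => by
      refine (hg1 _).trans_le ?_
      rw [← Function.iterate_succ_apply' g]
      exact hδ.1 ⟨n + 1, rfl⟩
    have hex : ∀ β < δ, ∃ n, β < g^[n] a := fun β hβ => by
      obtain ⟨_, ⟨n, rfl⟩, h⟩ := (lt_isLUB_iff hδ).1 hβ
      exact ⟨n, h⟩
    refine ⟨δ, ⟨isSuccLimit_of_forall (hlt 0) fun β hβ => ?_, fun β hβ γ hγ => ?_⟩, (hlt 0).le⟩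
    · obtain ⟨n, hn⟩ := hex β hβ
      exact ⟨_, hn, hlt n⟩
    · obtain ⟨n, hn⟩ := hex β hβ
      refine (hg2 _ β (hn.trans (hg1 _)) hn.le γ hγ).trans ?_
      rw [← Function.iterate_succ_apply' g]
      exact hlt (n + 1)

/-! ### Clubs of elementary submodels -/

/-- Binary function symbols indexed by `ι`. -/
inductive BinarySymbol (ι : Type) : ℕ → Type
  | mk : ι → BinarySymbol ι 2

/-- The language of the binary function symbols indexed by `ι`. -/
def binaryLanguage (ι : Type) : FirstOrder.Language := ⟨BinarySymbol ι, fun _ => Empty⟩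

theorem countable_functions_language (ι : Type) [Countable ι] :
    Countable (Σ l, ((setLanguage.sum setLanguage.skolem₁).sum (binaryLanguage ι)).Functions l) := by
  have h1 : Countable (Σ l, (setLanguage.sum setLanguage.skolem₁).Functions l) := by
    rw [← Cardinal.mk_le_aleph0_iff]
    refine FirstOrder.Language.card_functions_sum_skolem₁_le.trans (max_le le_rfl ?_)
    have : Countable setLanguage.Symbols := by
      have : Function.Injective (fun x : setLanguage.Symbols => (0 : ℕ)) := by
        rintro (⟨n, f⟩ | ⟨n, r⟩) (⟨m, g⟩ | ⟨m, s⟩) _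
        · exact f.elim
        · exact f.elim
        · exact g.elim
        · cases r; cases s; rfl
      exact this.countable
    exact Cardinal.mk_le_aleph0_iff.2 this
  have h2 : ∀ l, Countable ((setLanguage.sum setLanguage.skolem₁).Functions l) := fun l =>
    (sigma_mk_injective (β := (setLanguage.sum setLanguage.skolem₁).Functions) (i := l)).countable
  have h3 : ∀ l, Countable (BinarySymbol ι l) := fun l => by
    have : Function.Injective (fun x : BinarySymbol ι l => match x with | .mk k => k) := by
      rintro ⟨a⟩ ⟨b⟩ h
      exact congrArg _ h
    exact this.countable
  have : ∀ l, Countable (((setLanguage.sum setLanguage.skolem₁).sum (binaryLanguage ι)).Functions l) :=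
    fun l => @instCountableSum _ _ (h2 l) (h3 l)
  infer_instance

/-- Add Skolem functions and the operations `G k` to the language. Its substructures are
automatically elementary and closed under `G`. The language has countably many functions, so
countable sets generate countable substructures, and unions of chains are again substructures. -/
theorem exists_isClubOfSubmodels {κ : Cardinal.{0}} {ι : Type} [Countable ι] (x₀ : H κ) (G : ι → H κ → H κ → H κ) :
    ∃ C, IsClubOfSubmodels κ C ∧ ∀ N ∈ C, (x₀ : ZFSet) ∈ N ∧
      ∀ k (x y : H κ), (x : ZFSet) ∈ N → (y : ZFSet) ∈ N → (G k x y : ZFSet) ∈ N := by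
  have : Nonempty (H κ) := ⟨x₀⟩
  let _ : (binaryLanguage ι).Structure (H κ) :=
    ⟨fun f v => match f with | .mk k => G k (v 0) (v 1), fun r => r.elim⟩
  have hcount := countable_functions_language ι
  let L := (setLanguage.sum setLanguage.skolem₁).sum (binaryLanguage ι)
  let C : Set (Set ZFSet) := {N | ∃ M : L.Substructure (H κ),
    (M : Set (H κ)).Countable ∧ x₀ ∈ M ∧ N = Subtype.val '' (M : Set (H κ))}
  have hG : ∀ M : L.Substructure (H κ), ∀ k, ∀ x ∈ M, ∀ y ∈ M, G k x y ∈ M := by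
    intro M k x hx y hy
    refine M.fun_mem (Sum.inr (BinarySymbol.mk k) : L.Functions 2) ![x, y] fun i => ?_
    fin_cases i
    · exact hx
    · exact hy
  refine ⟨C, ⟨⟨?_, ?_, ?_, ?_⟩, ?_⟩, ?_⟩
  · rintro _ ⟨M, -, -, rfl⟩ _ ⟨x, -, rfl⟩
    exact x.2
  · rintro _ ⟨M, hM, -, rfl⟩
    exact hM.image _
  · intro M hM hMc
    refine ⟨_, ⟨FirstOrder.Language.Substructure.closure L (insert x₀ (Subtype.val ⁻¹' M)), ?_,
      FirstOrder.Language.Substructure.subset_closure (Set.mem_insert _ _), rfl⟩, ?_⟩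
    · exact ((hMc.preimage Subtype.val_injective).insert x₀).substructure_closure L
    · intro x hx
      exact ⟨⟨x, hM hx⟩, FirstOrder.Language.Substructure.subset_closure
        (Set.mem_insert_of_mem _ hx), rfl⟩
  · intro f hf hfC
    choose M hMc hx₀ hM using hfC
    have hmono : Monotone M := fun i j hij x hx => by
      have : (x : ZFSet) ∈ f j := hf hij (by rw [hM]; exact ⟨x, hx, rfl⟩)
      rw [hM] at this
      obtain ⟨y, hy, hxy⟩ := this
      rwa [← Subtype.ext hxy]
    have hmem : ∀ x, x ∈ ⨆ i, M i ↔ ∃ i, x ∈ M i := fun x =>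
      FirstOrder.Language.Substructure.mem_iSup_of_directed hmono.directed_le
    have hcoe : ((⨆ i, M i : L.Substructure (H κ)) : Set (H κ)) = ⋃ i, (M i : Set (H κ)) := by
      ext x
      simp [hmem]
    refine ⟨⨆ i, M i, ?_, (hmem _).2 ⟨0, hx₀ 0⟩, ?_⟩
    · rw [hcoe]
      exact Set.countable_iUnion hMc
    · rw [hcoe, Set.image_iUnion]
      exact Set.iUnion_congr hM
  · rintro _ ⟨M, -, -, rfl⟩
    exact ⟨(FirstOrder.Language.LHom.sumInl.substructureReduct M).elementarySkolem₁Reduct, rfl⟩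
  · rintro _ ⟨M, -, hx₀, rfl⟩
    refine ⟨⟨x₀, hx₀, rfl⟩, ?_⟩
    rintro k x y ⟨x', hx, hx'⟩ ⟨y', hy, hy'⟩
    obtain rfl := Subtype.ext hx'
    obtain rfl := Subtype.ext hy'
    exact ⟨_, hG M k _ hx _ hy, rfl⟩

theorem toZFSet_mem_H {κ : Cardinal.{0}} (hκ : Ordinal.toZFSet ω₁ ∈ H κ) (α : W) :
    α.1.toZFSet ∈ H κ :=
  ZFSet.Hereditarily.mem hκ (Ordinal.toZFSet_mem_toZFSet_iff.2 α.2)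

/-- Closure under enumerations of the countable ordinals makes the trace an initial segment; closure
under a next-element function of `C₀` makes its supremum a limit of members of `C₀`. -/
theorem exists_isClubOfSubmodels_traceEq {κ : Cardinal.{0}} (hκ : Ordinal.toZFSet ω₁ ∈ H κ)
    {C₀ : Set W} (hC₀ : IsClub C₀) {ι : Type} [Countable ι] (G : ι → H κ → H κ → H κ) :
    ∃ C, IsClubOfSubmodels κ C ∧ ∀ N ∈ C, (∃ δ ∈ C₀, TraceEq N δ) ∧
      ∀ k (x y : H κ), (x : ZFSet) ∈ N → (y : ZFSet) ∈ N → (G k x y : ZFSet) ∈ N := by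
  classical
  let o : W → H κ := fun α => ⟨_, toZFSet_mem_H hκ α⟩
  have ho : Function.Injective o := fun α β h =>
    Subtype.ext (Ordinal.toZFSet_injective (congrArg Subtype.val h))
  have hnext : ∀ α : W, ∃ β ∈ C₀, α < β := fun α => by
    obtain ⟨α', h⟩ := exists_gt' α
    obtain ⟨β, h1, h2⟩ := hC₀.isCofinal α'
    exact ⟨β, h1, h.trans_le h2⟩
  choose nx hnx hlt using hnext
  have henum : ∀ α : W, ∃ e : ℕ → W, ∀ β < α, ∃ n, e n = β := fun α => by
    rcases (Set.Iio α).eq_empty_or_nonempty with h | h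
    · exact ⟨fun _ => α, fun β hβ => (h.subset hβ).elim⟩
    · obtain ⟨e, he⟩ := (countable_Iio α).exists_eq_range h
      exact ⟨e, fun β hβ => he.subset hβ⟩
  choose e he using henum
  let z : W := ⟨0, Ordinal.omega_pos 1⟩
  -- Functions on `W` are transported to `H κ`, with the identity as the value off the ordinals.
  let lift : (W → W) → H κ → H κ := fun f x => if h : ∃ α, o α = x then o (f h.choose) else x
  have hlift : ∀ f α, lift f (o α) = o (f α) := fun f α => by
    have h : ∃ β, o β = o α := ⟨α, rfl⟩
    simp only [lift, dif_pos h, ho h.choose_spec]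
  -- The distinguished element `o z` keeps the trace nonempty.
  obtain ⟨C, hC, hCN⟩ := exists_isClubOfSubmodels (ι := Option (ℕ ⊕ ι)) (o z) fun i x y =>
    match i with
    | none => lift nx x
    | some (.inl n) => lift (e · n) x
    | some (.inr k) => G k x y
  refine ⟨C, hC, fun N hN => ?_⟩
  obtain ⟨hz, hcl⟩ := hCN N hN
  refine ⟨?_, fun k => hcl (some (.inr k))⟩
  let T : Set W := {α | (o α : ZFSet) ∈ N}
  have hTc : T.Countable := (hC.1.countable N hN).preimage
    (Subtype.val_injective.comp ho)
  have hTlow : ∀ α ∈ T, ∀ β < α, β ∈ T := fun α hα β hβ => by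
    obtain ⟨n, rfl⟩ := he α β hβ
    have := hcl (some (.inl n)) (o α) (o α) hα hα
    simp only [hlift] at this
    exact this
  have hTnx : ∀ α ∈ T, nx α ∈ T := fun α hα => by
    have := hcl none (o α) (o α) hα hα
    simp only [hlift] at this
    exact this
  obtain ⟨δ, hδ⟩ := exists_isLUB hTc
  have hT : ∀ α, α ∈ T ↔ α < δ := fun α => by
    refine ⟨fun h => (hlt α).trans_le (hδ.1 (hTnx α h)), fun h => ?_⟩
    obtain ⟨β, hβ, hαβ⟩ := (lt_isLUB_iff hδ).1 h
    exact hTlow β hβ α hαβ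
  refine ⟨δ, hC₀.isLUB_mem (t := nx '' T) ?_ ⟨_, ⟨z, hz, rfl⟩⟩ ⟨?_, ?_⟩, hT⟩
  · rintro _ ⟨α, -, rfl⟩
    exact hnx α
  · rintro _ ⟨α, hα, rfl⟩
    exact hδ.1 (hTnx α hα)
  · intro b hb
    exact hδ.2 fun α hα => (hlt α).le.trans (hb ⟨α, hα, rfl⟩)

/-! ### Generators of a uniserial module -/

section Modules

variable {R : Type*} [CommRing R] [IsDomain R] [ValuationRing R]
variable {Q : Type*} [Field Q] [Algebra R Q] [IsFractionRing R Q]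
variable {U : Type*} [AddCommGroup U] [Module R U]

omit [IsDomain R] [ValuationRing R] in
theorem mem_scaled {A : Submodule R Q} {r : R} (hr : r ≠ 0) {x : R} :
    x ∈ scaled A r ↔ (algebraMap R Q r)⁻¹ * algebraMap R Q x ∈ A := by
  have hr' : algebraMap R Q r ≠ 0 := by simpa using hr
  simp only [scaled, Submodule.mem_comap, Submodule.mem_map, Algebra.linearMap_apply,
    LinearMap.lsmul_apply, Algebra.smul_def]
  constructor
  · rintro ⟨q, hq, h⟩
    rwa [← h, inv_mul_cancel_left₀ hr']
  · exact fun h => ⟨_, h, mul_inv_cancel_left₀ hr' _⟩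

omit [IsDomain R] [ValuationRing R] [IsFractionRing R Q] in
theorem Generates.mem_iff {r : W → R} {J : Submodule R Q} (hr : Generates r J) {q : Q} :
    q ∈ J ↔ ∃ ν s, q = (algebraMap R Q (r ν))⁻¹ * algebraMap R Q s := by
  rw [← SetLike.mem_coe, hr.eq_iUnion]
  simp

omit [IsDomain R] [ValuationRing R] [IsFractionRing R Q] in
theorem Generates.dvd_of_le {r : W → R} {J : Submodule R Q} (hr : Generates r J) {σ τ : W}
    (h : σ ≤ τ) : r σ ∣ r τ := by
  rcases h.lt_or_eq with h | rfl
  · exact hr.dvd _ _ h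
  · rfl

omit [IsDomain R] [ValuationRing R] in
theorem Generates.inv_mul_eq {r : W → R} {J : Submodule R Q} (hr : Generates r J) {σ τ : W} {t : R}
    (h : r τ = r σ * t) (s : R) :
    (algebraMap R Q (r σ))⁻¹ * algebraMap R Q s =
      (algebraMap R Q (r τ))⁻¹ * algebraMap R Q (t * s) := by
  have h1 : algebraMap R Q (r σ) ≠ 0 := by simpa using hr.ne_zero σ
  have h2 : algebraMap R Q (r τ) ≠ 0 := by simpa using hr.ne_zero τ
  rw [h, map_mul] at *
  have h3 := right_ne_zero_of_mul h2
  rw [map_mul]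
  field_simp

omit [IsDomain R] [ValuationRing R] in
theorem Generates.exists_ge {r : W → R} {J : Submodule R Q} (hr : Generates r J) (ν₀ : W) {q : Q}
    (hq : q ∈ J) : ∃ ν ≥ ν₀, ∃ s, q = (algebraMap R Q (r ν))⁻¹ * algebraMap R Q s := by
  obtain ⟨ν, s, rfl⟩ := hr.mem_iff.1 hq
  obtain ⟨t, ht⟩ := hr.dvd_of_le (le_max_left ν ν₀)
  exact ⟨_, le_max_right ν ν₀, _, hr.inv_mul_eq ht s⟩

/-- Say `u = y v`. Then `1 - y` kills `x v ≠ 0`, so it is not a unit, and `y` is one because `R` is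
local. -/
theorem exists_unit_smul (hU : IsUniserial R U) {x : R} {u v : U} (h : x • u = x • v)
    (h0 : x • u ≠ 0) : ∃ e : Rˣ, u = e • v := by
  have key : ∀ {u v : U}, x • u = x • v → x • u ≠ 0 → u ∈ Submodule.span R {v} →
      ∃ e : Rˣ, u = e • v := by
    intro u v h h0 huv
    obtain ⟨y, rfl⟩ := Submodule.mem_span_singleton.1 huv
    have h1 : (1 - y) • x • v = 0 := by
      rw [sub_smul, one_smul, sub_eq_zero, smul_comm y x v, h]
    have h2 : ¬ IsUnit (1 - y) := fun hu => h0 (h.trans ((hu.smul_eq_zero).1 h1))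
    obtain ⟨e, he⟩ := (IsLocalRing.isUnit_or_isUnit_one_sub_self y).resolve_right h2
    exact ⟨e, by rw [← he, Units.smul_def]⟩
  rcases hU (Submodule.span R {u}) (Submodule.span R {v}) with H | H
  · exact key h h0 (H (Submodule.mem_span_singleton_self u))
  · obtain ⟨e, he⟩ := key h.symm (h ▸ h0) (H (Submodule.mem_span_singleton_self v))
    exact ⟨e⁻¹, by rw [he, inv_smul_smul]⟩

/-- A member of `D(a)` is of the form `y / t`, where `t` divides `a`. -/
theorem exists_divisor_of_mem {a : U} (ha : a ≠ 0) {q : Q} (hq : q ∈ divisorModule R Q a) :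
    ∃ t : R, t ≠ 0 ∧ (∃ b : U, t • b = a) ∧ ∃ y : R, algebraMap R Q t * q = algebraMap R Q y := by
  have hne : ∀ t : R, (∃ b : U, t • b = a) → t ≠ 0 := by
    rintro _ ⟨b, rfl⟩ rfl
    exact ha (zero_smul _ _)
  -- Closure under addition uses that of two divisors of `a` one divides the other, so a common
  -- denominator exists.
  let P : Submodule R Q :=
    { carrier := {q | ∃ t : R, t ≠ 0 ∧ (∃ b : U, t • b = a) ∧
        ∃ y : R, algebraMap R Q t * q = algebraMap R Q y}
      zero_mem' := ⟨1, one_ne_zero, ⟨a, one_smul _ _⟩, 0, by simp⟩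
      smul_mem' := by
        rintro c q ⟨t, h0, ht, y, hy⟩
        exact ⟨t, h0, ht, c * y, by rw [Algebra.smul_def, map_mul, ← hy]; ring⟩
      add_mem' := by
        rintro q q' ⟨t, h0, ht, y, hy⟩ ⟨t', h0', ht', y', hy'⟩
        rcases ValuationRing.dvd_total t t' with ⟨c, rfl⟩ | ⟨c, rfl⟩ <;>
          rw [map_mul] at *
        · exact ⟨t * c, h0', ht', c * y + y', by
            simp only [map_add, map_mul, ← hy, ← hy']; ring⟩
        · exact ⟨t' * c, h0, ht, y + c * y', by
            simp only [map_add, map_mul, ← hy, ← hy']; ring⟩ }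
  have hle : divisorModule R Q a ≤ P := by
    refine iSup₂_le fun t ht => ?_
    rw [Submodule.span_le, Set.singleton_subset_iff]
    refine ⟨t, hne t ht, ht, 1, ?_⟩
    rw [map_one, mul_inv_cancel₀ (by simpa using hne t ht)]
  exact hle hq

omit [ValuationRing R] [IsDomain R] [IsFractionRing R Q] in
theorem inv_mem_divisorModule {a b : U} {t : R} (h : t • b = a) :
    (algebraMap R Q t)⁻¹ ∈ divisorModule R Q a :=
  Submodule.mem_iSup_of_mem t (Submodule.mem_iSup_of_mem ⟨b, h⟩
    (Submodule.mem_span_singleton_self _))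

/-- The isomorphism `J / A ≅ D(a) / Ann(a)` is the multiplication by an element of `Q`. -/
theorem HasType.exists_scale {J A : Submodule R Q} (hT : HasType U J A) :
    ∃ a : U, a ≠ 0 ∧ ∃ s ∈ J, s ∉ A ∧ (∀ x : R, x • s ∈ A ↔ x • a = 0) ∧
      ∀ x : R, (∃ b : U, x • b = a) ↔ ∃ j ∈ J, x • j = s := by
  obtain ⟨a, ha, ⟨φ⟩⟩ := hT
  have h1 : (1 : Q) ∈ divisorModule R Q a := by
    simpa using inv_mem_divisorModule (R := R) (Q := Q) (one_smul R a)
  have hann : ∀ x : R, algebraMap R Q x ∈ annModule R Q a ↔ x • a = 0 := by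
    intro x
    rw [annModule, IsLocalization.mem_coeSubmodule]
    refine ⟨?_, fun h => ⟨x, h, rfl⟩⟩
    rintro ⟨y, hy, h⟩
    rw [← IsFractionRing.injective R Q h]
    exact hy
  have hmkJ : ∀ j : J, (A.submoduleOf J).mkQ j = 0 ↔ (j : Q) ∈ A := fun j => by
    rw [Submodule.mkQ_apply, Submodule.Quotient.mk_eq_zero]; rfl
  have hmkD : ∀ d : divisorModule R Q a,
      ((annModule R Q a).submoduleOf (divisorModule R Q a)).mkQ d = 0 ↔
        (d : Q) ∈ annModule R Q a := fun d => by
    rw [Submodule.mkQ_apply, Submodule.Quotient.mk_eq_zero]; rfl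
  -- The scaling element `s` represents the preimage of the class of `1`.
  obtain ⟨s, hs⟩ := Submodule.mkQ_surjective _
    (φ.symm (((annModule R Q a).submoduleOf (divisorModule R Q a)).mkQ ⟨1, h1⟩))
  have hs' := (LinearEquiv.eq_symm_apply _).1 hs
  have hiff : ∀ x : R, x • (s : Q) ∈ A ↔ x • a = 0 := by
    intro x
    rw [← hann, ← Submodule.coe_smul, ← hmkJ, ← φ.map_eq_zero_iff, map_smul, map_smul, hs',
      ← map_smul, hmkD]
    simp [Algebra.smul_def]
  have hsA : (s : Q) ∉ A := fun h => ha (by simpa using (hiff 1).1 (by simpa using h))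
  have hs0 : (s : Q) ≠ 0 := fun h => hsA (h ▸ A.zero_mem)
  refine ⟨a, ha, s, s.2, hsA, hiff, fun x => ⟨?_, ?_⟩⟩
  · rintro ⟨b, hb⟩
    have hx0 : algebraMap R Q x ≠ 0 := by
      rw [Ne, FaithfulSMul.algebraMap_eq_zero_iff]
      rintro rfl
      exact ha (by rw [← hb, zero_smul])
    obtain ⟨j, hj⟩ := Submodule.mkQ_surjective (A.submoduleOf J)
      (φ.symm (((annModule R Q a).submoduleOf (divisorModule R Q a)).mkQ
        ⟨_, inv_mem_divisorModule hb⟩))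
    have hj' := (LinearEquiv.eq_symm_apply _).1 hj
    have hd : x • (j : Q) - s ∈ A := by
      rw [← Submodule.coe_smul, ← Submodule.coe_sub, ← hmkJ, ← φ.map_eq_zero_iff, map_sub,
        map_sub, map_smul, map_smul, hj', hs', ← map_smul, ← map_sub, hmkD]
      simp [Algebra.smul_def, hx0]
    -- Otherwise the inverse quotient is integral and `s` is a multiple of `x j - s ∈ A`. For the
    -- same reason `m` is not a unit, so `x j = (1 + m) s` with `1 + m` a unit, which is then
    -- absorbed into `j`.
    have : ∃ m : R, algebraMap R Q m = (x • (j : Q) - s) / s := by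
      rcases ValuationRing.isInteger_or_isInteger R ((x • (j : Q) - s) / s) with h | ⟨n, hn⟩
      · exact h
      · by_cases h0 : x • (j : Q) - s = 0
        · exact ⟨0, by rw [h0, map_zero, zero_div]⟩
        · refine (hsA ?_).elim
          have : (s : Q) = n • (x • (j : Q) - s) := by
            rw [Algebra.smul_def, hn, inv_div, div_mul_cancel₀ _ h0]
          rw [this]
          exact A.smul_mem _ hd
    obtain ⟨m, hm⟩ := this
    rw [eq_div_iff hs0, ← Algebra.smul_def] at hm
    have hmu : ¬ IsUnit m := by
      rintro ⟨u, rfl⟩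
      rw [← hm] at hd
      exact hsA ((Submodule.smul_mem_iff_of_isUnit A u.isUnit).1 hd)
    obtain ⟨e, he⟩ : IsUnit (1 + m) := by
      refine (IsLocalRing.isUnit_or_isUnit_of_add_one (a := 1 + m) (b := -m) (by ring)).resolve_right ?_
      simpa using hmu
    refine ⟨((e⁻¹ : Rˣ) : R) • (j : Q), J.smul_mem _ j.2, ?_⟩
    have : x • (j : Q) = ((e : R)) • (s : Q) := by
      rw [he, add_smul, one_smul, hm]; abel
    rw [smul_comm, this, smul_smul, Units.inv_mul, one_smul]
  · rintro ⟨j, hj, hjs⟩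
    obtain ⟨d, hd⟩ := Submodule.mkQ_surjective
      ((annModule R Q a).submoduleOf (divisorModule R Q a)) (φ ((A.submoduleOf J).mkQ ⟨j, hj⟩))
    have hd' : algebraMap R Q x * d - 1 ∈ annModule R Q a := by
      have : (x • d - ⟨1, h1⟩ : divisorModule R Q a) = algebraMap R Q x * (d : Q) - 1 := by
        simp [Algebra.smul_def]
      rw [← this, ← hmkD, map_sub, map_smul, hd, ← hs', ← map_smul, ← map_smul, ← map_sub,
        ← map_sub, φ.map_eq_zero_iff, hmkJ]
      simp [hjs]
    -- Here `x d = 1 + n` with `n` killing `a`, so `1 + n` is a unit. Writing `d = y / t` gives `x y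
    -- = t (1 + n)`, whence `x` divides `a` because `t` does.
    obtain ⟨n, hn, hnd⟩ := (IsLocalization.mem_coeSubmodule _ _).1 hd'
    have hn0 : n • a = 0 := hn
    obtain ⟨t, ht0, ⟨b, hb⟩, y, hy⟩ := exists_divisor_of_mem ha d.2
    have hxy : x * y = t * (1 + n) := by
      apply IsFractionRing.injective R Q
      rw [map_mul, map_mul, ← hy, map_add, hnd, map_one]; ring
    obtain ⟨e, he⟩ : IsUnit (1 + n) := by
      refine (IsLocalRing.isUnit_or_isUnit_of_add_one (a := 1 + n) (b := -n) (by ring)).resolve_right ?_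
      rw [IsUnit.neg_iff]
      exact fun h => ha (h.smul_eq_zero.1 hn0)
    refine ⟨y • ((e⁻¹ : Rˣ) : R) • b, ?_⟩
    rw [smul_smul, smul_smul, hxy, ← he, mul_assoc, Units.mul_inv, mul_one, hb]

/-- Since `a` corresponds to `s ∈ J`, an element corresponding to `r_ν⁻¹` is a solution `b ν` of
`(r_ν s) b = a`. The coefficient `r_ν s` lies in `R` once `ν ≥ ν₀`; smaller indices receive
multiples of `b ν₀`. Two solutions differ by a unit, by `exists_unit_smul`. -/
theorem exists_generators {J A : Submodule R Q} {r : W → R} (hr : Generates r J)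
    (hU : IsUniserial R U) (hT : HasType U J A) :
    ∃ a : W → U, (∀ ν x, x • a ν = 0 ↔ x ∈ scaled A (r ν)) ∧ (∀ u, ∃ ν, ∃ t : R, u = t • a ν) ∧
      ∀ σ τ, σ ≤ τ → ∀ t, r τ = r σ * t → ∃ e : Rˣ, a σ = e • t • a τ := by
  obtain ⟨a, ha, s, hsJ, hsA, hann, hdiv⟩ := hT.exists_scale
  obtain ⟨ν₀, s₀, hs₀⟩ := hr.mem_iff.1 hsJ
  have hs0 : s ≠ 0 := fun h => hsA (h ▸ A.zero_mem)
  have hr0 : ∀ ν, algebraMap R Q (r ν) ≠ 0 := fun ν => by simpa using hr.ne_zero ν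
  have hy : ∀ ν, ν₀ ≤ ν → ∃ y : R, algebraMap R Q y = algebraMap R Q (r ν) * s := fun ν hν => by
    obtain ⟨t, ht⟩ := hr.dvd_of_le hν
    refine ⟨t * s₀, ?_⟩
    rw [hs₀, hr.inv_mul_eq ht, mul_inv_cancel_left₀ (hr0 ν)]
  choose! y hy using hy
  have hb : ∀ ν, ν₀ ≤ ν → ∃ b : U, y ν • b = a := fun ν hν => by
    refine (hdiv _).2 ⟨(algebraMap R Q (r ν))⁻¹, hr.mem_iff.2 ⟨ν, 1, by simp⟩, ?_⟩
    rw [Algebra.smul_def, hy ν hν]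
    have := hr0 ν
    field_simp
  choose! b hb using hb
  have hbann : ∀ ν, ν₀ ≤ ν → ∀ x, x • b ν = 0 ↔ x ∈ scaled A (r ν) := fun ν hν x => by
    rw [mem_scaled (hr.ne_zero ν)]
    rcases ValuationRing.dvd_total (y ν) x with ⟨w, rfl⟩ | ⟨w, hw⟩
    · rw [mul_comm, mul_smul, hb ν hν, ← hann, Algebra.smul_def, map_mul, hy ν hν]
      have := hr0 ν
      field_simp
    · refine iff_of_false (fun h => ha ?_) fun h => hsA ?_
      · rw [← hb ν hν, hw, mul_comm, mul_smul, h, smul_zero]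
      · have : s = w • ((algebraMap R Q (r ν))⁻¹ * algebraMap R Q x) := by
          have h1 := hy ν hν
          have := hr0 ν
          rw [hw, map_mul] at h1
          rw [Algebra.smul_def]
          field_simp
          linear_combination -h1
        rw [this]
        exact A.smul_mem _ h
  have hbe : ∀ σ τ, ν₀ ≤ σ → σ ≤ τ → ∀ p, r τ = r σ * p → ∃ e : Rˣ, b σ = e • p • b τ := by
    intro σ τ hσ h p hp
    refine exists_unit_smul (x := y σ) hU ?_ (by rwa [hb σ hσ])
    rw [hb σ hσ, ← hb τ (hσ.trans h), smul_smul]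
    congr 1
    apply IsFractionRing.injective R Q
    rw [map_mul, hy σ hσ, hy τ (hσ.trans h), hp, map_mul]
    ring
  have ht : ∀ ν, ∃ t, r (max ν ν₀) = r ν * t := fun ν => hr.dvd_of_le (le_max_left ν ν₀)
  choose t ht using ht
  have htb : ∀ ν, ν₀ ≤ ν → t ν • b (max ν ν₀) = b ν := fun ν hν => by
    have h := ht ν
    rw [max_eq_left hν] at h ⊢
    rw [(mul_eq_left₀ (hr.ne_zero ν)).1 h.symm, one_smul]
  refine ⟨fun ν => t ν • b (max ν ν₀), fun ν x => ?_, fun u => ?_, fun σ τ hστ p hp => ?_⟩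
  · rw [smul_smul, hbann _ (le_max_right _ _), mem_scaled (hr.ne_zero _),
      mem_scaled (hr.ne_zero _), hr.inv_mul_eq (ht ν), mul_comm x]
  · rcases hU (Submodule.span R {u}) (Submodule.span R {a}) with H | H
    · obtain ⟨x, hx⟩ := Submodule.mem_span_singleton.1 (H (Submodule.mem_span_singleton_self u))
      exact ⟨ν₀, x * y ν₀, by beta_reduce; rw [htb _ le_rfl, mul_smul, hb _ le_rfl, hx]⟩
    -- Here `a = x u`, so `s = x j` with `j = w / r_ν` in `J`. Then `x u = x (w b_ν) ≠ 0`, and `u`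
    -- is a unit multiple of `w b_ν`.
    · obtain ⟨x, hx⟩ := Submodule.mem_span_singleton.1 (H (Submodule.mem_span_singleton_self a))
      obtain ⟨j, hj, hjs⟩ := (hdiv x).1 ⟨u, hx⟩
      obtain ⟨ν, hν, w, rfl⟩ := hr.exists_ge ν₀ hj
      have hxw : y ν = x * w := by
        apply IsFractionRing.injective R Q
        rw [hy ν hν, ← hjs, Algebra.smul_def, map_mul]
        have := hr0 ν
        field_simp
      obtain ⟨e, he⟩ := exists_unit_smul (x := x) (u := u) (v := w • b ν) hU
        (by rw [smul_smul, ← hxw, hb ν hν, hx]) (by rwa [hx])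
      exact ⟨ν, e * w, by beta_reduce; rw [htb _ hν, mul_smul, he, Units.smul_def]⟩
  · obtain ⟨q, hq⟩ := hr.dvd_of_le (max_le_max_right ν₀ hστ)
    obtain ⟨e, he⟩ := hbe _ _ (le_max_right _ _) (max_le_max_right ν₀ hστ) q hq
    refine ⟨e, ?_⟩
    have : t σ * q = p * t τ := by
      apply mul_left_cancel₀ (hr.ne_zero σ)
      rw [← mul_assoc, ← ht, ← hq, ht, hp, mul_assoc]
    beta_reduce
    rw [he, smul_comm (t σ) e, smul_smul, smul_smul, this]

omit [IsDomain R] [ValuationRing R] in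
-- Coherence makes `r_ν⁻¹ s ↦ s x_ν` well defined on `J`; the annihilators give kernel `A`.
theorem nonempty_equiv_of_coherent {J A : Submodule R Q} {r : W → R} (hr : Generates r J)
    {x : W → U} (hx : ∀ ν y, y • x ν = 0 ↔ y ∈ scaled A (r ν))
    (hcov : ∀ u, ∃ ν, ∃ t : R, u = t • x ν)
    (hcoh : ∀ σ τ, σ ≤ τ → ∀ t, r τ = r σ * t → x σ = t • x τ) :
    Nonempty (U ≃ₗ[R] (J ⧸ A.submoduleOf J)) := by
  have hr0 : ∀ ν, algebraMap R Q (r ν) ≠ 0 := fun ν => by simpa using hr.ne_zero ν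
  have hwd : ∀ σ τ s s', (algebraMap R Q (r σ))⁻¹ * algebraMap R Q s =
      (algebraMap R Q (r τ))⁻¹ * algebraMap R Q s' → s • x σ = s' • x τ := by
    have key : ∀ σ τ s s', σ ≤ τ → (algebraMap R Q (r σ))⁻¹ * algebraMap R Q s =
        (algebraMap R Q (r τ))⁻¹ * algebraMap R Q s' → s • x σ = s' • x τ := by
      intro σ τ s s' h h'
      obtain ⟨t, ht⟩ := hr.dvd_of_le h
      rw [hr.inv_mul_eq ht] at h'
      have := IsFractionRing.injective R Q (mul_left_cancel₀ (inv_ne_zero (hr0 τ)) h')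
      rw [hcoh σ τ h t ht, ← this, smul_smul, mul_comm]
    intro σ τ s s' h
    rcases le_total σ τ with h' | h'
    · exact key σ τ s s' h' h
    · exact (key τ σ s' s h' h.symm).symm
  have hex : ∀ q : J, ∃ u, ∀ σ s, (q : Q) = (algebraMap R Q (r σ))⁻¹ * algebraMap R Q s →
      u = s • x σ := by
    rintro ⟨q, hq⟩
    obtain ⟨ν, s, rfl⟩ := hr.mem_iff.1 hq
    exact ⟨s • x ν, fun σ s' h => hwd _ _ _ _ h⟩
  choose f hf using hex
  let F : J →ₗ[R] U :=
    { toFun := f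
      map_add' := fun p q => by
        obtain ⟨ν, s, hs⟩ := hr.mem_iff.1 p.2
        obtain ⟨τ, hτ, s', hs'⟩ := hr.exists_ge ν q.2
        obtain ⟨t, ht⟩ := hr.dvd_of_le hτ
        rw [hr.inv_mul_eq ht] at hs
        rw [hf p _ _ hs, hf q _ _ hs', ← add_smul]
        apply hf
        rw [Submodule.coe_add, hs, hs', map_add, mul_add]
      map_smul' := fun c p => by
        obtain ⟨ν, s, hs⟩ := hr.mem_iff.1 p.2
        rw [hf p _ _ hs, RingHom.id_apply, smul_smul]
        apply hf
        rw [Submodule.coe_smul, hs, Algebra.smul_def, map_mul]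
        ring }
  have hker : LinearMap.ker F = A.submoduleOf J := by
    ext p
    obtain ⟨ν, s, hs⟩ := hr.mem_iff.1 p.2
    rw [LinearMap.mem_ker, Submodule.submoduleOf, Submodule.mem_comap, Submodule.subtype_apply, hs, ← mem_scaled (hr.ne_zero ν), ← hx]
    change f p = 0 ↔ _
    rw [hf p _ _ hs]
  have hsurj : Function.Surjective F := fun u => by
    obtain ⟨ν, t, rfl⟩ := hcov u
    exact ⟨⟨_, hr.mem_iff.2 ⟨ν, t, rfl⟩⟩, hf _ _ _ rfl⟩
  exact ⟨((Submodule.quotEquivOfEq _ _ hker.symm).trans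
    (F.quotKerEquivOfSurjective hsurj)).symm⟩

end Modules

/-! ### Cocycles of units and the tree of partial solutions -/

section Cocycle

variable {R : Type*} [CommRing R]

theorem _root_.SModEq.of_mul_unit {I : Ideal R} {x y : R} (u : Rˣ)
    (h : x * u ≡ y * u [SMOD I]) : x ≡ y [SMOD I] := by
  simpa [mul_assoc] using h.mul (SModEq.refl ((u⁻¹ : Rˣ) : R))

/-- A family of units `E σ τ` with `E σ τ * E τ ρ ≡ E σ ρ` modulo `I σ`. -/
structure IsUnitCocycle (I : W → Ideal R) (E : W → W → Rˣ) : Prop where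
  anti : Antitone I
  self : ∀ σ, E σ σ = 1
  mul : ∀ σ τ ρ, σ ≤ τ → τ ≤ ρ → (E σ τ * E τ ρ : R) ≡ E σ ρ [SMOD I σ]

/-- `q` is a partial solution that extends the partial solution `p`. -/
def Extends (I : W → Ideal R) (E : W → W → Rˣ) (p q : W × Rˣ) : Prop :=
  p.1 ≤ q.1 ∧ (p.2 * E p.1 q.1 : R) ≡ q.2 [SMOD I p.1]

variable {I : W → Ideal R} {E : W → W → Rˣ}

theorem Extends.refl (h : IsUnitCocycle I E) (p : W × Rˣ) : Extends I E p p :=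
  ⟨le_rfl, by simp [h.self]⟩

theorem Extends.trans (h : IsUnitCocycle I E) {p q s : W × Rˣ} (h1 : Extends I E p q)
    (h2 : Extends I E q s) : Extends I E p s := by
  refine ⟨h1.1.trans h2.1, ?_⟩
  have e1 := (SModEq.refl (p.2 : R)).mul (h.mul _ _ _ h1.1 h2.1).symm
  have e2 := h1.2.mul (SModEq.refl (E q.1 s.1 : R))
  rw [mul_assoc] at e2
  exact e1.trans (e2.trans (h2.2.mono (h.anti h1.1)))

/-- The unit `E q.1 s.1` cancels. Hence conditions with a common extension are comparable up to
height, as in a tree. -/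
theorem Extends.of_common (h : IsUnitCocycle I E) {p q s : W × Rˣ} (h1 : Extends I E p s)
    (h2 : Extends I E q s) (hpq : p.1 ≤ q.1) : Extends I E p q := by
  refine ⟨hpq, SModEq.of_mul_unit (E q.1 s.1) ?_⟩
  rw [mul_assoc]
  have e1 := (SModEq.refl (p.2 : R)).mul (h.mul _ _ _ hpq h2.1)
  exact e1.trans (h1.2.trans (h2.2.mono (h.anti hpq)).symm)

theorem extends_of_nat (h : IsUnitCocycle I E) {p : ℕ → W × Rˣ}
    (hp : ∀ n, Extends I E (p n) (p (n + 1))) {n m : ℕ} (hnm : n ≤ m) :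
    Extends I E (p n) (p m) := by
  induction m, hnm using Nat.le_induction with
  | base => exact .refl h _
  | succ m _ ih => exact ih.trans h (hp m)

theorem extends_mul_right (E : W → W → Rˣ) {σ τ : W} (h : σ ≤ τ) (c : Rˣ) :
    Extends I E (σ, c) (τ, c * E σ τ) :=
  ⟨h, by simp⟩

theorem extends_mul_inv (E : W → W → Rˣ) {σ τ : W} (h : σ ≤ τ) (c : Rˣ) :
    Extends I E (σ, c * (E σ τ)⁻¹) (τ, c) :=
  ⟨h, by simp⟩

/-- A subring `M` with `R* ∩ M = M*`. -/
def HasUnits (M : Subring R) : Prop := ∀ u : Rˣ, (u : R) ∈ M → ((u⁻¹ : Rˣ) : R) ∈ M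

/-- Build the units along a cofinal `ω`-sequence in `δ`, then pull each value down to the heights in
between. Only units of `M` occur. -/
theorem exists_coherent_branch (h : IsUnitCocycle I E) {δ : W} (hδ : Order.IsSuccLimit δ)
    {M : Subring R} (hM : HasUnits M) (hE : ∀ σ < δ, ∀ τ < δ, (E σ τ : R) ∈ M) :
    ∃ b : W → Rˣ, (∀ σ < δ, (b σ : R) ∈ M) ∧
      ∀ σ τ, σ ≤ τ → τ < δ → Extends I E (σ, b σ) (τ, b τ) := by
  have : Nonempty (Set.Iio δ) := by
    obtain ⟨a, ha⟩ := not_isMin_iff.1 hδ.1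
    exact ⟨a, ha⟩
  obtain ⟨s, hs, hst⟩ := Filter.exists_seq_monotone_tendsto_atTop_atTop (Set.Iio δ)
  have hn : ∀ σ : W, ∃ n, σ < δ → σ ≤ s n := fun σ => by
    by_cases hσ : σ < δ
    · obtain ⟨n, hn⟩ := (hst.eventually_ge_atTop ⟨σ, hσ⟩).exists
      exact ⟨n, fun _ => hn⟩
    · exact ⟨0, fun h => absurd h hσ⟩
  choose n hn using hn
  obtain ⟨c, hc0, hcs⟩ : ∃ c : ℕ → Rˣ, c 0 = 1 ∧ ∀ k, c (k + 1) = c k * E (s k) (s (k + 1)) :=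
    ⟨fun k => Nat.rec 1 (fun k c => c * E (s k) (s (k + 1))) k, rfl, fun _ => rfl⟩
  have hc : ∀ k, Extends I E (s k, c k) (s (k + 1), c (k + 1)) := fun k => by
    rw [hcs]
    exact extends_mul_right E (hs k.le_succ) (c k)
  have hcM : ∀ k, (c k : R) ∈ M := fun k => by
    induction k with
    | zero => simp [hc0]
    | succ k ih =>
      rw [hcs, Units.val_mul]
      exact M.mul_mem ih (hE _ (s k).2 _ (s (k + 1)).2)
  let b : W → Rˣ := fun σ => c (n σ) * (E σ (s (n σ)))⁻¹
  have hb : ∀ σ < δ, ∀ k, n σ ≤ k → Extends I E (σ, b σ) (s k, c k) := fun σ hσ k hk =>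
    (extends_mul_inv E (hn σ hσ) (c (n σ))).trans h (extends_of_nat h (p := fun k => (↑(s k), c k)) hc hk)
  refine ⟨b, fun σ hσ => ?_, fun σ τ hστ hτ => ?_⟩
  · exact M.mul_mem (hcM _) (hM _ (hE _ hσ _ (s _).2))
  · exact (hb σ (hστ.trans_lt hτ) _ (le_max_left (n σ) (n τ))).of_common h
      (hb τ hτ _ (le_max_right (n σ) (n τ))) hστ

end Cocycle

/-! ### Limits of partial solutions at a countable limit height -/

section Branches

variable {R : Type*} [CommRing R] {Q : Type*} [Field Q] [Algebra R Q]
variable {A : Submodule R Q} {r : W → R} {E : W → W → Rˣ}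

/-- A coherent branch `b` in `M` gives the Cauchy sequence `u σ = b σ * E σ δ`, which need have no
limit. Replacing `b` by `u⁻¹ f b` changes it to the convergent `f`, and a suitable `f` keeps the
values in `M`. -/
theorem exists_convergent_branch (h : IsUnitCocycle (fun ν => scaled A (r ν)) E) {δ : W}
    (hδ : Order.IsSuccLimit δ) {M : Subring R} (hM : HasUnits M)
    (hE : ∀ σ < δ, ∀ τ < δ, (E σ τ : R) ∈ M)
    (hΓ' : ∀ u ∈ cauchyUnits A r δ, ∃ f ∈ convergentUnits A r δ, ∀ σ, (u σ : R) * f σ ∈ M) :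
    ∃ (b : W → Rˣ) (β : Rˣ), ∀ σ < δ, (b σ : R) ∈ M ∧
      Extends (fun ν => scaled A (r ν)) E (σ, b σ) (δ, β) := by
  obtain ⟨b, hbM, hb⟩ := exists_coherent_branch h hδ hM hE
  let u : Set.Iio δ → Rˣ := fun σ => b σ * E σ δ
  have hu : ∀ σ τ : Set.Iio δ, σ < τ → (u τ : R) ≡ u σ [SMOD scaled A (r σ)] := by
    intro σ τ hστ
    have e1 := (hb σ τ hστ.le τ.2).2.mul (SModEq.refl (E τ δ : R))
    have e2 := (SModEq.refl (b σ : R)).mul (h.mul σ τ δ hστ.le τ.2.le)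
    rw [mul_assoc] at e1
    simpa [u] using e1.symm.trans e2
  -- The inverse sequence is used because the required factor is `u⁻¹ f`.
  have huinv : (fun σ => (u σ)⁻¹) ∈ cauchyUnits A r δ := by
    intro σ τ hστ
    rw [← SModEq.sub_mem]
    apply SModEq.of_mul_unit (u σ * u τ)
    have := (hu σ τ hστ).symm
    push_cast
    rw [mul_comm (u σ : R), Units.inv_mul_cancel_left, mul_comm (u τ : R),
      Units.inv_mul_cancel_left]
    exact this
  obtain ⟨f, ⟨-, l, hl⟩, hfM⟩ := hΓ' _ huinv
  refine ⟨fun σ => if hσ : σ < δ then (u ⟨σ, hσ⟩)⁻¹ * f ⟨σ, hσ⟩ * b σ else 1, l, fun σ hσ => ?_⟩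
  simp only [hσ, dif_pos]
  refine ⟨M.mul_mem (hfM ⟨σ, hσ⟩) (hbM σ hσ), hσ.le, ?_⟩
  have : (u ⟨σ, hσ⟩)⁻¹ * f ⟨σ, hσ⟩ * b σ * E σ δ = f ⟨σ, hσ⟩ := by
    simp only [u]
    rw [mul_assoc, mul_comm (b σ * _)⁻¹, inv_mul_cancel_right]
  rw [← Units.val_mul, this]
  exact (SModEq.sub_mem.2 (hl ⟨σ, hσ⟩)).symm

theorem exists_limit_of_complete [IsLocalRing R]
    (h : IsUnitCocycle (fun ν => scaled A (r ν)) E) {δ : W} (hδ : Order.IsSuccLimit δ)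
    (hδΓ : δ ∉ gammaSet A r) {p : ℕ → W × Rˣ} (hpδ : ∀ n, (p n).1 < δ)
    (hcof : ∀ α < δ, ∃ n, α < (p n).1)
    (hp : ∀ n, Extends (fun ν => scaled A (r ν)) E (p n) (p (n + 1))) :
    ∃ l : Rˣ, ∀ n, Extends (fun ν => scaled A (r ν)) E (p n) (δ, l) := by
  have hcomp := not_not.1 fun hc => hδΓ ⟨hδ, hc⟩
  let u : ℕ → Rˣ := fun n => (p n).2 * E (p n).1 δ
  have hu : ∀ n m, n ≤ m → (u n : R) ≡ u m [SMOD scaled A (r (p n).1)] := by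
    intro n m hnm
    have hext := extends_of_nat h hp hnm
    have e1 := hext.2.mul (SModEq.refl (E (p m).1 δ : R))
    have e2 := (SModEq.refl ((p n).2 : R)).mul (h.mul _ _ _ hext.1 (hpδ m).le)
    rw [mul_assoc] at e1
    simpa [u] using e2.symm.trans e1
  have hmem : ∀ (i : Set.Iio δ) (x : R), Ideal.Quotient.mk (colonIdeal A r δ) x ∈
      (scaled A (r i)).map (Ideal.Quotient.mk (colonIdeal A r δ)) ↔ x ∈ scaled A (r i) :=
    fun i x => Ideal.mem_quotient_iff_mem (iInf_le _ i)
  obtain ⟨y, hy⟩ := hcomp (fun n => Ideal.Quotient.mk _ (u n : R)) fun i => by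
    obtain ⟨n, hn⟩ := hcof i i.2
    refine ⟨n, fun k hk l hl => ?_⟩
    rw [← map_sub, hmem, ← SModEq.sub_mem]
    exact ((hu n k hk).symm.trans (hu n l hl)).mono (h.anti hn.le)
  obtain ⟨l, rfl⟩ := Ideal.Quotient.mk_surjective y
  have hl : ∀ n, (u n : R) ≡ l [SMOD scaled A (r (p n).1)] := by
    intro n
    obtain ⟨m, hm⟩ := hy ⟨_, hpδ n⟩
    have := hm _ (le_max_right n m)
    rw [← map_sub, hmem, ← SModEq.sub_mem] at this
    exact (hu n _ (le_max_left n m)).trans this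
  -- The limit of units is a unit as soon as one of the ideals is proper. If none is, all the
  -- congruences are vacuous and `1` serves.
  by_cases htop : ∃ n, scaled A (r (p n).1) ≠ ⊤
  · obtain ⟨n, hn⟩ := htop
    have hlu : IsUnit l := by
      by_contra hl'
      have h1 := IsLocalRing.le_maximalIdeal hn (SModEq.sub_mem.1 (hl n))
      have h2 := (Ideal.add_mem_iff_left _ ((IsLocalRing.mem_maximalIdeal l).2 hl')).2 h1
      rw [sub_add_cancel] at h2
      exact h2 (u n).isUnit
    obtain ⟨l, rfl⟩ := hlu
    exact ⟨l, fun n => ⟨(hpδ n).le, by simpa [u] using hl n⟩⟩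
  · push Not at htop
    refine ⟨1, fun n => ⟨(hpδ n).le, ?_⟩⟩
    dsimp only
    rw [htop n]
    exact SModEq.top

theorem exists_basic_subset {M : Subring R} {δ : W} (hne : (Set.Iio δ).Nonempty)
    {V : Set (Tree A r M δ)} (hV : IsOpen V) {v : Tree A r M δ} (hv : v ∈ V) :
    ∃ ν : Set.Iio δ, ∀ v' : Tree A r M δ, (∀ σ ≤ ν, v'.1 σ = v.1 σ) → v' ∈ V := by
  induction hV with
  | basic s hs =>
    obtain ⟨u, ν, rfl⟩ := hs
    exact ⟨ν, fun v' h σ hσ => (h σ hσ).trans (hv σ hσ)⟩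
  | univ => exact ⟨⟨_, hne.some_mem⟩, fun _ _ => trivial⟩
  | inter s t _ _ ihs iht =>
    obtain ⟨ν, hν⟩ := ihs hv.1
    obtain ⟨ρ, hρ⟩ := iht hv.2
    exact ⟨max ν ρ, fun v' h => ⟨hν v' fun σ hσ => h σ (hσ.trans (le_max_left _ _)),
      hρ v' fun σ hσ => h σ (hσ.trans (le_max_right _ _))⟩⟩
  | sUnion S _ ih =>
    obtain ⟨s, hs, hvs⟩ := hv
    obtain ⟨ν, hν⟩ := ih s hs hvs
    exact ⟨ν, fun v' h => ⟨s, hs, hν v' h⟩⟩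

theorem isOpen_basic {M : Subring R} {δ : W} (v : Tree A r M δ) (ν : Set.Iio δ) :
    IsOpen {v' : Tree A r M δ | ∀ σ ≤ ν, v'.1 σ = v.1 σ} :=
  TopologicalSpace.isOpen_generateFrom_of_mem ⟨v, ν, rfl⟩

/-- The branch of a constant sequence. -/
def constBranch (A : Submodule R Q) (r : W → R) {M : Subring R} (δ : W) (z : Rˣ)
    (hz : (z : R) ∈ M) : Tree A r M δ :=
  ⟨fun _ => Ideal.Quotient.mk _ (z : R), fun _ => z, fun σ τ _ => by simp,
    fun _ => hz, fun _ => rfl⟩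

/-- The partial solutions that belong to a submodel with trace `δ` on `ω₁` and `M` on `R`. -/
def InModel (M : Subring R) (δ : W) (p : W × Rˣ) : Prop := p.1 < δ ∧ (p.2 : R) ∈ M

/-- Multiplying a tree branch by the convergent branch `b` gives a branch of partial solutions; if
the former converges to `l`, the latter has limit `l * β`. A non-meagre set of convergent branches
near `p` meets countably many dense open sets at once. -/
theorem exists_generic_of_nonmeagre (h : IsUnitCocycle (fun ν => scaled A (r ν)) E) {δ : W}
    (hδ : Order.IsSuccLimit δ) {M : Subring R} (hM : HasUnits M)
    (hE : ∀ σ < δ, ∀ τ < δ, (E σ τ : R) ∈ M)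
    (hΓ' : ∀ u ∈ cauchyUnits A r δ, ∃ f ∈ convergentUnits A r δ, ∀ σ, (u σ : R) * f σ ∈ M)
    (hcat : ∀ V : Set (Tree A r M δ), IsOpen V → V.Nonempty →
      ¬ IsMeagre (V ∩ convergentBranches A r M δ))
    {p : W × Rˣ} (hp : InModel M δ p) {ι : Type*} [Countable ι] (D : ι → Set (W × Rˣ))
    (hD : ∀ i p, InModel M δ p → ∃ d ∈ D i, InModel M δ d ∧
      Extends (fun ν => scaled A (r ν)) E p d) :
    ∃ l : Rˣ, Extends (fun ν => scaled A (r ν)) E p (δ, l) ∧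
      ∀ i, ∃ d ∈ D i, InModel M δ d ∧ Extends (fun ν => scaled A (r ν)) E d (δ, l) := by
  obtain ⟨b, β, hb⟩ := exists_convergent_branch h hδ hM hE hΓ'
  have hcoh : ∀ σ τ, σ ≤ τ → τ < δ → Extends (fun ν => scaled A (r ν)) E (σ, b σ) (τ, b τ) :=
    fun σ τ hστ hτ => (hb σ (hστ.trans_lt hτ)).2.of_common h (hb τ hτ).2 hστ
  -- `O i` consists of the branches whose product with `b` passes through a condition of `D i` in
  -- the model.
  let O : ι → Set (Tree A r M δ) := fun i => {v | ∃ d ∈ D i, InModel M δ d ∧ ∃ hd : d.1 < δ,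
    v.1 ⟨d.1, hd⟩ * Ideal.Quotient.mk _ (b d.1 : R) = Ideal.Quotient.mk _ (d.2 : R)}
  have hO : ∀ i, IsOpen (O i) := fun i => by
    refine isOpen_iff_forall_mem_open.2 fun v hv => ?_
    obtain ⟨d, hdD, hdM, hd, hvd⟩ := hv
    refine ⟨_, fun v' hv' => ⟨d, hdD, hdM, hd, ?_⟩, isOpen_basic v ⟨d.1, hd⟩, fun σ _ => rfl⟩
    rw [hv' _ le_rfl, hvd]
  have hOd : ∀ i, Dense (O i) := fun i => by
    refine dense_iff_inter_open.2 fun V hV ⟨v, hv⟩ => ?_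
    obtain ⟨ν, hν⟩ := exists_basic_subset ⟨p.1, hp.1⟩ hV hv
    obtain ⟨u, hu, huM, hvu⟩ := v.2
    obtain ⟨d, hdD, hdM, hd⟩ := hD i (ν, u ν * b ν) ⟨ν.2, M.mul_mem (huM ν) (hb ν ν.2).1⟩
    -- The constant branch with this value, multiplied by `b`, passes through `d`. As `d` extends
    -- `(ν, u ν * b ν)`, cancelling `b ν` and `E ν d.1` shows that it agrees with `v` up to `ν`.
    have hz : ((d.2 * (b d.1)⁻¹ : Rˣ) : R) ∈ M :=
      M.mul_mem hdM.2 (hM _ (hb _ hdM.1).1)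
    refine ⟨constBranch A r δ _ hz, hν _ fun σ hσ => ?_, d, hdD, hdM, hdM.1, ?_⟩
    · rw [hvu]
      have e1 := (hcoh ν d.1 hd.1 hdM.1).2
      have e2 := (SModEq.refl ((d.2 * (b d.1)⁻¹ : Rˣ) : R)).mul e1
      dsimp only at e2
      rw [← Units.val_mul _ (b d.1), inv_mul_cancel_right] at e2
      have e4 := e2.trans hd.2.symm
      dsimp only at e4
      rw [Units.val_mul (u ν), mul_assoc (u ν : R), ← Units.val_mul (b _)] at e4
      have e5 := e4.of_mul_unit
      have e6 : (u ν : R) ≡ u σ [SMOD scaled A (r σ)] := by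
        rcases hσ.lt_or_eq with hσ | rfl
        · exact SModEq.sub_mem.2 (hu σ ν hσ)
        · exact SModEq.refl _
      exact (e5.mono (h.anti hσ)).trans e6
    · change Ideal.Quotient.mk _ _ * _ = _
      rw [← map_mul, ← Units.val_mul, inv_mul_cancel_right]
  have hres : (⋂ i, O i) ∈ residual (Tree A r M δ) :=
    countable_iInter_mem.2 fun i => residual_of_dense_open (hO i) (hOd i)
  have hz₀ : ((p.2 * (b p.1)⁻¹ : Rˣ) : R) ∈ M := M.mul_mem hp.2 (hM _ (hb _ hp.1).1)
  let v₀ : Tree A r M δ := constBranch A r δ _ hz₀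
  obtain ⟨v, ⟨hv, w, ⟨-, l, hl⟩, hvw⟩, hvO⟩ : (({v' : Tree A r M δ |
      ∀ σ ≤ (⟨p.1, hp.1⟩ : Set.Iio δ), v'.1 σ = v₀.1 σ} ∩ convergentBranches A r M δ) ∩
        ⋂ i, O i).Nonempty := by
    by_contra hempty
    refine hcat _ (isOpen_basic v₀ ⟨p.1, hp.1⟩) ⟨v₀, fun _ _ => rfl⟩ ?_
    refine Filter.mem_of_superset hres fun v hv hv' => hempty ⟨v, hv', hv⟩
  have key : ∀ d : W × Rˣ, ∀ hd : d.1 < δ,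
      v.1 ⟨d.1, hd⟩ * Ideal.Quotient.mk _ (b d.1 : R) = Ideal.Quotient.mk _ (d.2 : R) →
        Extends (fun ν => scaled A (r ν)) E d (δ, l * β) := by
    intro d hd hvd
    refine ⟨hd.le, ?_⟩
    rw [hvw, ← map_mul] at hvd
    have e0 : (w ⟨d.1, hd⟩ * b d.1 : R) ≡ d.2 [SMOD scaled A (r d.1)] := hvd
    have e1 := (SModEq.refl (l : R)).mul (hb d.1 hd).2.2
    have e2 := e0.mul (SModEq.refl (E d.1 δ : R))
    rw [mul_assoc] at e2
    rw [Units.val_mul]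
    exact e2.symm.trans ((((SModEq.sub_mem.2 (hl ⟨d.1, hd⟩)).symm).mul
      (SModEq.refl (b d.1 * E d.1 δ : R))).trans e1)
  refine ⟨l * β, key p hp.1 ?_, fun i => ?_⟩
  · rw [hv _ le_rfl]
    change Ideal.Quotient.mk _ _ * _ = _
    rw [← map_mul, ← Units.val_mul, inv_mul_cancel_right]
  · obtain ⟨d, hdD, hdM, hd, hvd⟩ := Set.mem_iInter.1 hvO i
    exact ⟨d, hdD, hdM, key d hd hvd⟩

end Branches

/-! ### The forcing poset -/

/-- Subsets of `P` belong to `H κ` because the power set of `P` does, so `α ↦ Δ α` and a choice of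
an extension in a given dense set are operations on `H κ` under which submodels can be closed. -/
theorem SetPoset.exists_submodels (P : SetPoset) (hP : P.carrier = Ordinal.toZFSet ω₁)
    {κ : Cardinal.{0}} (hκ : P.IsLargeEnough κ) {C₀ : Set W} (hC₀ : IsClub C₀) {Δ : W → ZFSet}
    (hΔ : ∀ α, Δ α ⊆ P.carrier) :
    ∃ C, IsClubOfSubmodels κ C ∧ ∀ N ∈ C, (∃ δ ∈ C₀, TraceEq N δ) ∧
      (∀ α : W, α.1.toZFSet ∈ N → Δ α ∈ N) ∧
      ∀ D ∈ N, P.IsDenseSet D → ∀ p : P.carrier, (p : ZFSet) ∈ N →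
        ∃ d : P.carrier, (d : ZFSet) ∈ D ∧ (d : ZFSet) ∈ N ∧ P.le p d := by
  classical
  have hsub : ∀ D ⊆ P.carrier, D ∈ H κ := fun D hD =>
    ZFSet.Hereditarily.mem hκ.2 (ZFSet.mem_powerset.2 hD)
  have hPκ : P.carrier ∈ H κ := hsub _ fun _ h => h
  have hmem : ∀ p : P.carrier, (p : ZFSet) ∈ H κ := fun p => ZFSet.Hereditarily.mem hPκ p.2
  have hω : Ordinal.toZFSet ω₁ ∈ H κ := hP ▸ hPκ
  have hf : ∀ x : H κ, ∃ y : H κ, ∀ α : W, α.1.toZFSet = x → (y : ZFSet) = Δ α := fun x => by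
    by_cases h : ∃ α : W, α.1.toZFSet = x
    · obtain ⟨α, hα⟩ := h
      refine ⟨⟨Δ α, hsub _ (hΔ α)⟩, fun β hβ => ?_⟩
      rw [Subtype.ext (Ordinal.toZFSet_injective (hα.trans hβ.symm))]
    · exact ⟨x, fun α hα => (h ⟨α, hα⟩).elim⟩
  choose f hf using hf
  have hg : ∀ x y : H κ, ∃ z : H κ, P.IsDenseSet x → ∀ p : P.carrier, (p : ZFSet) = y →
      ∃ d : P.carrier, (d : ZFSet) = z ∧ (d : ZFSet) ∈ (x : ZFSet) ∧ P.le p d := fun x y => by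
    by_cases h : P.IsDenseSet x ∧ (y : ZFSet) ∈ P.carrier
    · obtain ⟨d, hd, hle⟩ := h.1.2 ⟨y, h.2⟩
      refine ⟨⟨d, hmem d⟩, fun _ p hp => ⟨d, rfl, hd, ?_⟩⟩
      rwa [show p = ⟨y, h.2⟩ from Subtype.ext hp]
    · exact ⟨x, fun hx p hp => (h ⟨hx, hp ▸ p.2⟩).elim⟩
  choose g hg using hg
  obtain ⟨C, hC, hCN⟩ := exists_isClubOfSubmodels_traceEq hω hC₀ (ι := Bool)
    fun i x y => if i then f x else g x y
  refine ⟨C, hC, fun N hN => ?_⟩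
  obtain ⟨hδ, hcl⟩ := hCN N hN
  refine ⟨hδ, fun α hα => ?_, fun D hD hDd p hp => ?_⟩
  · have := hcl true ⟨_, toZFSet_mem_H hω α⟩ ⟨_, toZFSet_mem_H hω α⟩ hα hα
    simpa [hf ⟨_, toZFSet_mem_H hω α⟩ α rfl] using this
  · have := hcl false ⟨D, hsub D hDd.1⟩ ⟨p, hmem p⟩ hD hp
    obtain ⟨d, hd, hdD, hle⟩ := hg ⟨D, hsub D hDd.1⟩ ⟨p, hmem p⟩ hDd p rfl
    refine ⟨d, hdD, ?_, hle⟩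
    rw [hd]
    simpa using this

/-- The members of `ω₁` in the sense of `ZFC`. -/
noncomputable def omegaOneEquiv : W ≃ (Ordinal.toZFSet ω₁ : ZFSet.{0}) :=
  Equiv.ofBijective (fun α => ⟨α.1.toZFSet, Ordinal.toZFSet_mem_toZFSet_iff.2 α.2⟩)
    ⟨fun _ _ h => Subtype.ext (Ordinal.toZFSet_injective (congrArg Subtype.val h)), fun x => by
      obtain ⟨a, ha, h⟩ := Ordinal.mem_toZFSet_iff.1 x.2
      exact ⟨⟨a, ha⟩, Subtype.ext h⟩⟩

theorem omegaOneEquiv_apply (α : W) : (omegaOneEquiv α : ZFSet) = α.1.toZFSet := rfl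

theorem exists_equiv_W {X : Type*} [Nonempty X] (hX : Cardinal.mk X ≤ ℵ₁) :
    Nonempty (W ≃ W × X) := by
  have h1 : Cardinal.lift.{1} (Cardinal.mk X) ≤ Cardinal.lift (Cardinal.mk W) := by
    rw [mk_W, Cardinal.lift_lift]
    simp [hX]
  obtain ⟨f⟩ := Cardinal.lift_mk_le'.1 h1
  have hinf : ℵ₀ ≤ #W := by
    rw [mk_W]
    simp
  have h2 : #(W × W) = #W := by
    rw [Cardinal.mk_prod, Cardinal.lift_id, Cardinal.mul_eq_self hinf]
  obtain ⟨e⟩ := Cardinal.eq.1 h2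
  obtain ⟨x⟩ := ‹Nonempty X›
  exact Function.Embedding.antisymm ⟨fun α => (α, x), fun α β h => (Prod.ext_iff.1 h).1⟩
    (((Function.Embedding.refl W).prodMap f).trans e.toEmbedding)

section Poset

variable {R : Type*} [CommRing R] {I : W → Ideal R} {E : W → W → Rˣ}

/-- The poset of partial solutions, coded by countable ordinals. -/
noncomputable def solutionPoset (h : IsUnitCocycle I E) (w : W ≃ W × Rˣ) : SetPoset where
  carrier := Ordinal.toZFSet ω₁
  -- Strict growth of the height ensures antisymmetry: distinct conditions of equal height may have
  -- congruent units.
  le x y := x = y ∨ (w (omegaOneEquiv.symm x)).1 < (w (omegaOneEquiv.symm y)).1 ∧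
    Extends I E (w (omegaOneEquiv.symm x)) (w (omegaOneEquiv.symm y))
  le_refl _ := Or.inl rfl
  le_trans := by
    rintro p q s (rfl | ⟨h1, h2⟩) (rfl | ⟨h3, h4⟩)
    · exact Or.inl rfl
    · exact Or.inr ⟨h3, h4⟩
    · exact Or.inr ⟨h1, h2⟩
    · exact Or.inr ⟨h1.trans h3, h2.trans h h4⟩
  le_antisymm := by
    rintro p q (rfl | ⟨h1, -⟩) (h3 | ⟨h3, -⟩)
    · rfl
    · rfl
    · exact h3.symm
    · exact (lt_asymm h1 h3).elim

variable (h : IsUnitCocycle I E) (w : W ≃ W × Rˣ)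

/-- The partial solution coded by a member of the poset. -/
noncomputable def solutionPoset.decode : (solutionPoset h w).carrier ≃ W × Rˣ :=
  omegaOneEquiv.symm.trans w

variable {h w}

theorem solutionPoset.le_iff {x y : (solutionPoset h w).carrier} :
    (solutionPoset h w).le x y ↔ x = y ∨ (decode h w x).1 < (decode h w y).1 ∧
      Extends I E (decode h w x) (decode h w y) := Iff.rfl

theorem solutionPoset.extends_of_le {x y : (solutionPoset h w).carrier}
    (hxy : (solutionPoset h w).le x y) : Extends I E (decode h w x) (decode h w y) := by
  rcases le_iff.1 hxy with rfl | ⟨-, hxy⟩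
  · exact .refl h _
  · exact hxy

theorem solutionPoset.le_symm_of_extends {x : (solutionPoset h w).carrier} {q : W × Rˣ}
    (hlt : (decode h w x).1 < q.1) (hxq : Extends I E (decode h w x) q) :
    (solutionPoset h w).le x ((decode h w).symm q) :=
  le_iff.2 (Or.inr (by simpa using ⟨hlt, hxq⟩))

theorem solutionPoset.isDense_height (ν : W) :
    (solutionPoset h w).IsDense {x | ν < (decode h w x).1} := by
  intro x
  obtain ⟨τ, hτ⟩ := exists_gt' (max ν (decode h w x).1)
  have hlt := (le_max_right _ _).trans_lt hτ
  refine ⟨(decode h w).symm (τ, (decode h w x).2 * E (decode h w x).1 τ), ?_,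
    le_symm_of_extends hlt (extends_mul_right E hlt.le _)⟩
  simpa using (le_max_left _ _).trans_lt hτ

/-- Downward closure truncates a high condition of `G` to every height `ν`; directedness makes these
truncations coherent. -/
theorem solutionPoset.exists_of_isGeneric {G : Set (solutionPoset h w).carrier}
    (hG : (solutionPoset h w).IsGeneric (fun ν : W => {x | ν < (decode h w x).1}) G) :
    ∃ c : W → Rˣ, ∀ σ τ, σ ≤ τ → Extends I E (σ, c σ) (τ, c τ) := by
  have hex : ∀ ν : W, ∃ c : Rˣ, (decode h w).symm (ν, c) ∈ G := fun ν => by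
    obtain ⟨x, hx, hν⟩ := hG.meets ν
    refine ⟨(decode h w x).2 * (E ν (decode h w x).1)⁻¹, hG.downward _ x ?_ hx⟩
    refine le_iff.2 (Or.inr ?_)
    simpa using ⟨hν, extends_mul_inv E (le_of_lt hν) _⟩
  choose c hc using hex
  refine ⟨c, fun σ τ hστ => ?_⟩
  obtain ⟨s, -, h1, h2⟩ := hG.directed _ (hc σ) _ (hc τ)
  have h1 := extends_of_le h1
  have h2 := extends_of_le h2
  rw [Equiv.apply_symm_apply] at h1 h2
  exact h1.of_common h h2 hστ

/-- The dense set of the partial solutions of height `> ν`, as a set of `ZFC`. -/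
noncomputable def solutionPoset.heightSet (h : IsUnitCocycle I E) (w : W ≃ W × Rˣ) (ν : W) :
    ZFSet :=
  ZFSet.sep (fun z => ∃ hz : z ∈ (solutionPoset h w).carrier, ν < (decode h w ⟨z, hz⟩).1)
    (solutionPoset h w).carrier

theorem solutionPoset.mem_heightSet {ν : W} {x : (solutionPoset h w).carrier} :
    (x : ZFSet) ∈ heightSet h w ν ↔ ν < (decode h w x).1 := by
  rw [heightSet, ZFSet.mem_sep]
  exact ⟨fun hx => hx.2.2, fun hx => ⟨x.2, x.2, hx⟩⟩

theorem solutionPoset.isDenseSet_heightSet (ν : W) :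
    (solutionPoset h w).IsDenseSet (heightSet h w ν) := by
  refine ⟨fun z hz => (ZFSet.mem_sep.1 hz).1, fun x => ?_⟩
  obtain ⟨d, hd, hle⟩ := isDense_height (h := h) (w := w) ν x
  exact ⟨d, mem_heightSet.2 hd, hle⟩

/-- Conditions are coded by ordinals, so the trace on `ω₁` determines which conditions a submodel
contains. -/
theorem solutionPoset.mem_iff_of_traceEq {N : Set ZFSet} {δ : W} (hN : TraceEq N δ) {M : Subring R}
    (hw : ∀ i, i < δ ↔ InModel M δ (w i)) (x : (solutionPoset h w).carrier) :
    (x : ZFSet) ∈ N ↔ InModel M δ (decode h w x) := by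
  obtain ⟨α, rfl⟩ := omegaOneEquiv.surjective x
  rw [omegaOneEquiv_apply, hN α, hw α]
  change _ ↔ InModel M δ (w (omegaOneEquiv.symm (omegaOneEquiv α)))
  rw [Equiv.symm_apply_apply]

theorem TraceEq.unique {N : Set ZFSet} {δ δ' : W} (h : TraceEq N δ) (h' : TraceEq N δ') :
    δ = δ' :=
  Set.Iio_injective (Set.ext fun α => (h α).symm.trans (h' α))

end Poset

theorem IsFiltration.hasUnits {R : Type*} [CommRing R] {r : W → R} {N : W → Subring R}
    (hN : IsFiltration r N) (δ : W) : HasUnits (N δ) := by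
  intro u hu
  obtain ⟨y, hy, h⟩ := hN.units δ u hu u.isUnit
  rwa [Units.inv_eq_of_mul_eq_one_right h]

/-- Closure points of the coding, of its inverse and of the ranks of the units `E σ τ` in the
filtration. -/
theorem IsFiltration.exists_isClub {R : Type*} [CommRing R] {r : W → R} {N : W → Subring R}
    (hN : IsFiltration r N) (w : W ≃ W × Rˣ) (E : W → W → Rˣ) :
    ∃ C, IsClub C ∧ ∀ δ ∈ C, Order.IsSuccLimit δ ∧ (∀ i, i < δ ↔ InModel (N δ) δ (w i)) ∧
      ∀ σ < δ, ∀ τ < δ, (E σ τ : R) ∈ N δ := by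
  choose rk hrk using hN.exhaustive
  have hic : ∀ β : W, (Set.Iic β).Countable := fun β =>
    ((countable_Iio β).insert β).mono fun α hα => by
      rcases (Set.mem_Iic.1 hα).lt_or_eq with h | h
      · exact Or.inr h
      · exact Or.inl h
  refine ⟨_, isClub_closed (fun β => {(w β).1, rk (w β).2} ∪
    (w ⁻¹' (Set.Iic β ×ˢ {u : Rˣ | (u : R) ∈ N β}) ∪
      ⋃ σ ∈ Set.Iic β, ⋃ τ ∈ Set.Iic β, {rk (E σ τ)})) fun β => ?_, fun δ hδ => ?_⟩
  · refine ((Set.countable_singleton _).insert _).union (Set.Countable.union ?_ ?_)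
    · refine Set.Countable.preimage ?_ w.injective
      exact (hic β).prod ((hN.countable β).preimage Units.val_injective)
    · exact (hic β).biUnion fun σ _ => (hic β).biUnion fun τ _ => Set.countable_singleton _
  · obtain ⟨hlim, hcl⟩ := hδ
    refine ⟨hlim, fun i => ⟨fun hi => ⟨?_, ?_⟩, fun hi => ?_⟩, fun σ hσ τ hτ => ?_⟩
    · exact hcl i hi _ (Or.inl (Or.inl rfl))
    · exact hN.mono (hcl i hi _ (Or.inl (Or.inr rfl))).le (hrk _)
    · obtain ⟨β, hβ, hm⟩ := hN.continuous δ hlim _ hi.2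
      refine hcl (max β (w i).1) (max_lt hβ hi.1) i (Or.inr (Or.inl ?_))
      exact ⟨le_max_right β (w i).1, hN.mono (le_max_left _ _) hm⟩
    · refine hN.mono (hcl (max σ τ) (max_lt hσ hτ) (rk (E σ τ)) (Or.inr (Or.inr ?_))).le (hrk _)
      simp only [Set.mem_iUnion]
      exact ⟨σ, le_max_left σ τ, τ, le_max_right σ τ, rfl⟩

/-! ### Upper bounds and generic conditions over a countable submodel -/

namespace solutionPoset

variable {R : Type*} [CommRing R] {Q : Type*} [Field Q] [Algebra R Q]
variable {A : Submodule R Q} {r : W → R} {E : W → W → Rˣ}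
variable {h : IsUnitCocycle (fun ν => scaled A (r ν)) E} {w : W ≃ W × Rˣ}
variable {X : Set ZFSet.{0}} {δ : W} {M : Subring R}

/-- Meeting the height sets in `X` makes the chain cofinal in `δ`, so completeness at `δ` applies.
-/
theorem exists_bound [IsLocalRing R] (hX : TraceEq X δ) (hδ : Order.IsSuccLimit δ)
    (hw : ∀ i, i < δ ↔ InModel M δ (w i)) (hXΔ : ∀ α < δ, heightSet h w α ∈ X)
    (hδΓ : δ ∉ gammaSet A r) {p : ℕ → (solutionPoset h w).carrier}
    (hp : ∀ n, (solutionPoset h w).le (p n) (p (n + 1))) (hpX : ∀ n, (p n : ZFSet) ∈ X)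
    (hpD : ∀ D ∈ X, (solutionPoset h w).IsDenseSet D → ∃ n, (p n : ZFSet) ∈ D) :
    ∃ q, ∀ n, (solutionPoset h w).le (p n) q := by
  have hpδ : ∀ n, (decode h w (p n)).1 < δ := fun n =>
    ((mem_iff_of_traceEq hX hw _).1 (hpX n)).1
  obtain ⟨l, hl⟩ := exists_limit_of_complete h hδ hδΓ hpδ (fun α hα => by
    obtain ⟨n, hn⟩ := hpD _ (hXΔ α hα) (isDenseSet_heightSet α)
    exact ⟨n, mem_heightSet.1 hn⟩) fun n => extends_of_le (hp n)
  exact ⟨(decode h w).symm (δ, l), fun n => le_symm_of_extends (hpδ n) (hl n)⟩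

theorem exists_isNGeneric_of_complete [IsLocalRing R] (hX : TraceEq X δ) (hXc : X.Countable)
    (hδ : Order.IsSuccLimit δ) (hw : ∀ i, i < δ ↔ InModel M δ (w i))
    (hXΔ : ∀ α < δ, heightSet h w α ∈ X)
    (hXD : ∀ D ∈ X, (solutionPoset h w).IsDenseSet D → ∀ p : (solutionPoset h w).carrier,
      (p : ZFSet) ∈ X → ∃ d : (solutionPoset h w).carrier, (d : ZFSet) ∈ D ∧ (d : ZFSet) ∈ X ∧
        (solutionPoset h w).le p d)
    (hδΓ : δ ∉ gammaSet A r) (p : (solutionPoset h w).carrier) (hp : (p : ZFSet) ∈ X) :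
    ∃ q, (solutionPoset h w).le p q ∧ (solutionPoset h w).IsNGeneric X q := by
  obtain ⟨α, hα⟩ := not_isMin_iff.1 hδ.1
  obtain ⟨D, hD⟩ := (hXc.mono (s₁ := {D ∈ X | (solutionPoset h w).IsDenseSet D})
    fun _ h => h.1).exists_eq_range ⟨_, hXΔ α hα, isDenseSet_heightSet α⟩
  have hD' : ∀ n, D n ∈ X ∧ (solutionPoset h w).IsDenseSet (D n) := fun n =>
    hD.superset ⟨n, rfl⟩
  choose g hgD hgX hg using fun n => hXD (D n) (hD' n).1 (hD' n).2
  -- A chain in `X` above `p` entering the `n`-th dense set at step `n + 1`; an upper bound of it is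
  -- generic, since the chain's members are below it.
  obtain ⟨s, hs0, hs⟩ : ∃ s : ℕ → {x : (solutionPoset h w).carrier // (x : ZFSet) ∈ X},
      s 0 = ⟨p, hp⟩ ∧ ∀ n, s (n + 1) = ⟨g n (s n).1 (s n).2, hgX n _ _⟩ :=
    ⟨fun n => Nat.rec ⟨p, hp⟩ (fun n x => ⟨g n x.1 x.2, hgX n _ _⟩) n, rfl, fun _ => rfl⟩
  have hsD : ∀ n, ((s (n + 1)).1 : ZFSet) ∈ D n := fun n => by
    rw [hs]
    exact hgD n _ _
  obtain ⟨q, hq⟩ := exists_bound hX hδ hw hXΔ hδΓ (p := fun n => (s n).1)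
    (fun n => by rw [hs]; exact hg n _ _) (fun n => (s n).2) fun E hE hEd => by
      obtain ⟨n, rfl⟩ := hD.subset ⟨hE, hEd⟩
      exact ⟨n + 1, hsD n⟩
  refine ⟨q, by simpa [hs0] using hq 0, fun E hE hEd x hx => ?_⟩
  obtain ⟨n, rfl⟩ := hD.subset ⟨hE, hEd⟩
  exact ⟨_, hsD n, (s (n + 1)).2, x, SetPoset.le_refl _ x, SetPoset.le_trans _ _ _ _ (hq _) hx⟩

/-- The countably many dense sets of `X` are decoded into sets of partial solutions. The resulting
`(δ, l)` lies above a member of each that belongs to `X`, so every extension of it is compatible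
with that member. -/
theorem exists_isNGeneric_of_nonmeagre (hX : TraceEq X δ) (hXc : X.Countable)
    (hδ : Order.IsSuccLimit δ) (hw : ∀ i, i < δ ↔ InModel M δ (w i))
    (hXD : ∀ D ∈ X, (solutionPoset h w).IsDenseSet D → ∀ p : (solutionPoset h w).carrier,
      (p : ZFSet) ∈ X → ∃ d : (solutionPoset h w).carrier, (d : ZFSet) ∈ D ∧ (d : ZFSet) ∈ X ∧
        (solutionPoset h w).le p d)
    (hM : HasUnits M) (hE : ∀ σ < δ, ∀ τ < δ, (E σ τ : R) ∈ M)
    (hΓ' : ∀ u ∈ cauchyUnits A r δ, ∃ f ∈ convergentUnits A r δ, ∀ σ, (u σ : R) * f σ ∈ M)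
    (hcat : ∀ V : Set (Tree A r M δ), IsOpen V → V.Nonempty →
      ¬ IsMeagre (V ∩ convergentBranches A r M δ))
    (p : (solutionPoset h w).carrier) (hp : (p : ZFSet) ∈ X) :
    ∃ q, (solutionPoset h w).le p q ∧ (solutionPoset h w).IsNGeneric X q := by
  have hin := mem_iff_of_traceEq (h := h) hX hw
  have := (hXc.mono (s₁ := {D ∈ X | (solutionPoset h w).IsDenseSet D}) fun _ h => h.1).to_subtype
  obtain ⟨l, hl, hlD⟩ := exists_generic_of_nonmeagre h hδ hM hE hΓ' hcat ((hin p).1 hp)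
    (fun D : {D ∈ X | (solutionPoset h w).IsDenseSet D} =>
      {d | ((decode h w).symm d : ZFSet) ∈ D.1}) fun D c hc => by
    obtain ⟨d, hdD, hdX, hd⟩ := hXD D D.2.1 D.2.2 ((decode h w).symm c)
      ((hin _).2 (by simpa using hc))
    exact ⟨decode h w d, by simpa using hdD, (hin d).1 hdX, by simpa using extends_of_le hd⟩
  refine ⟨(decode h w).symm (δ, l), le_symm_of_extends ((hin p).1 hp).1 hl,
    fun D hD hDd x hx => ?_⟩
  obtain ⟨d, hdD, hdM, hd⟩ := hlD ⟨D, hD, hDd⟩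
  refine ⟨(decode h w).symm d, hdD, (hin _).2 (by simpa using hdM), x, SetPoset.le_refl _ x,
    SetPoset.le_trans _ _ _ _ (le_symm_of_extends ?_ ?_) hx⟩
  · simpa using hdM.1
  · simpa using hd

end solutionPoset

/-- Under the hypotheses of the theorem every cocycle of units is trivial. -/
theorem exists_coherent_units {S : Set W} (hS : AxiomS S) {R : Type*} [CommRing R] [IsLocalRing R]
    (hR : Cardinal.mk R = ℵ₁) {Q : Type*} [Field Q] [Algebra R Q] {A : Submodule R Q} {r : W → R}
    (hΓ : LeModClub (gammaSet A r) S) {N : W → Subring R} (hN : IsFiltration r N)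
    (hΓ' : EqModClub (gammaPrimeSet A r N) ∅)
    (hcat : ∀ δ ∈ S, ∀ V : Set (Tree A r (N δ) δ), IsOpen V → V.Nonempty →
      ¬ IsMeagre (V ∩ convergentBranches A r (N δ) δ))
    {E : W → W → Rˣ} (h : IsUnitCocycle (fun ν => scaled A (r ν)) E) :
    ∃ c : W → Rˣ, ∀ σ τ, σ ≤ τ → Extends (fun ν => scaled A (r ν)) E (σ, c σ) (τ, c τ) := by
  obtain ⟨w⟩ : Nonempty (W ≃ W × Rˣ) := exists_equiv_W
    ((Cardinal.mk_le_of_injective Units.val_injective).trans hR.le)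
  obtain ⟨C₁, hC₁, hC₁S⟩ := hΓ
  obtain ⟨C₂, hC₂, hC₂E⟩ := hΓ'
  obtain ⟨C₃, hC₃, hC₃M⟩ := hN.exists_isClub w E
  have hclub := (hC₁.inter cof_W_ne hC₂).inter cof_W_ne hC₃
  have hnotΓ : ∀ δ ∈ C₁, δ ∉ S → δ ∉ gammaSet A r := fun δ h1 h2 h3 => h2 (hC₁S ⟨h3, h1⟩).1
  have hsub : ∀ α, solutionPoset.heightSet h w α ⊆ (solutionPoset h w).carrier := fun α =>
    (solutionPoset.isDenseSet_heightSet α).1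
  obtain ⟨G, hG⟩ := hS.2.2 (solutionPoset h w) (by simp [solutionPoset]) (by
    intro κ hκ
    obtain ⟨C, hC, hCN⟩ := SetPoset.exists_submodels _ rfl hκ hclub hsub
    refine ⟨C, hC, fun X hX p hp => ?_⟩
    obtain ⟨⟨δ, ⟨⟨hδ1, hδ2⟩, hδ3⟩, hXδ⟩, hXΔ, hXD⟩ := hCN X hX
    obtain ⟨hlim, hw, hE⟩ := hC₃M δ hδ3
    -- On `S` the category hypothesis and `Γ' = 0` are used; off `S`, completeness at `δ`.
    by_cases hδS : δ ∈ S
    · refine solutionPoset.exists_isNGeneric_of_nonmeagre hXδ (hC.1.countable X hX) hlim hw hXD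
        (hN.hasUnits δ) hE (fun u hu => ?_) (hcat δ hδS) p hp
      by_contra hu'
      push Not at hu'
      exact (hC₂E.subset ⟨⟨hlim, u, hu, hu'⟩, hδ2⟩).1
    · exact solutionPoset.exists_isNGeneric_of_complete hXδ (hC.1.countable X hX) hlim hw
        (fun α hα => hXΔ α ((hXδ α).2 hα)) hXD (hnotΓ δ hδ1 hδS) p hp) (by
    intro κ hκ
    obtain ⟨C, hC, hCN⟩ := SetPoset.exists_submodels _ rfl hκ hclub hsub
    refine ⟨C, hC, fun X hX δ hδS hXδ p hp hpX hpD => ?_⟩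
    obtain ⟨⟨δ', ⟨⟨hδ1, hδ2⟩, hδ3⟩, hXδ'⟩, hXΔ, hXD⟩ := hCN X hX
    obtain rfl := hXδ.unique hXδ'
    obtain ⟨hlim, hw, hE⟩ := hC₃M δ hδ3
    exact solutionPoset.exists_bound hXδ hlim hw (fun α hα => hXΔ α ((hXδ α).2 hα))
      (hnotΓ δ hδ1 hδS) hp hpX hpD)
    (fun ν => {x | ν < (solutionPoset.decode h w x).1}) solutionPoset.isDense_height
  exact solutionPoset.exists_of_isGeneric hG

/-- Both `E σ τ * E τ ρ` and `E σ ρ` carry the same multiple of `a ρ` to `a σ`. Their difference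
kills that multiple, hence `a σ`, so it lies in `r_σ A`. -/
theorem exists_unitCocycle {R : Type*} [CommRing R] [IsDomain R] [ValuationRing R]
    {Q : Type*} [Field Q] [Algebra R Q] [IsFractionRing R Q] {J A : Submodule R Q} {r : W → R}
    (hr : Generates r J) {U : Type*} [AddCommGroup U] [Module R U] {a : W → U}
    (ha : ∀ ν x, x • a ν = 0 ↔ x ∈ scaled A (r ν))
    (hae : ∀ σ τ, σ ≤ τ → ∀ t, r τ = r σ * t → ∃ e : Rˣ, a σ = e • t • a τ) :
    ∃ E : W → W → Rˣ, IsUnitCocycle (fun ν => scaled A (r ν)) E ∧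
      ∀ σ τ, σ ≤ τ → ∀ t, r τ = r σ * t → a σ = E σ τ • t • a τ := by
  have hex : ∀ σ τ : W, ∃ e : Rˣ, (σ = τ → e = 1) ∧
      (σ ≤ τ → ∀ t, r τ = r σ * t → a σ = e • t • a τ) := by
    intro σ τ
    rcases eq_or_ne σ τ with rfl | hne
    · refine ⟨1, fun _ => rfl, fun _ t ht => ?_⟩
      rw [(mul_eq_left₀ (hr.ne_zero σ)).1 ht.symm, one_smul, one_smul]
    · by_cases h : σ ≤ τ
      · obtain ⟨t, ht⟩ := hr.dvd_of_le h
        obtain ⟨e, he⟩ := hae σ τ h t ht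
        refine ⟨e, fun h => (hne h).elim, fun _ t' ht' => ?_⟩
        rwa [mul_left_cancel₀ (hr.ne_zero σ) (ht'.symm.trans ht)]
      · exact ⟨1, fun _ => rfl, fun h' => (h h').elim⟩
  choose E hE1 hE using hex
  refine ⟨E, ⟨?_, fun σ => hE1 σ σ rfl, ?_⟩, hE⟩
  · intro σ τ hστ x hx
    obtain ⟨t, ht⟩ := hr.dvd_of_le hστ
    have h := (ha τ x).2 hx
    rw [← ha, hE σ τ hστ t ht, smul_comm x (E σ τ), smul_comm x t, h, smul_zero, smul_zero]
  · intro σ τ ρ hστ hτρ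
    obtain ⟨t, ht⟩ := hr.dvd_of_le hστ
    obtain ⟨s, hs⟩ := hr.dvd_of_le hτρ
    have hts : r ρ = r σ * (t * s) := by rw [hs, ht, mul_assoc]
    have h1 := hE σ τ hστ t ht
    rw [hE τ ρ hτρ s hs, smul_comm t (E τ ρ), smul_smul t s, smul_smul] at h1
    have h2 := hE σ ρ (hστ.trans hτρ) _ hts
    rw [SModEq.sub_mem, ← ha]
    have h3 : ((E σ τ * E τ ρ : R) - E σ ρ) • (t * s) • a ρ = 0 := by
      rw [sub_smul, sub_eq_zero, ← Units.val_mul]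
      exact h1.symm.trans h2
    rw [h2, smul_comm _ (E σ ρ), h3, smul_zero]

end Uniserial

theorem theorem13
    -- the stationary and co-stationary set given by Ax(S)
    (S : Set Uniserial.W) (hS : Uniserial.AxiomS S)
    -- a valuation domain of cardinality `ℵ₁` with quotient field `Q`
    {R : Type*} [CommRing R] [IsDomain R] [ValuationRing R] (hR : Cardinal.mk R = ℵ₁)
    {Q : Type*} [Field Q] [Algebra R Q] [IsFractionRing R Q]
    -- a type `J / A` and generators `r_ν⁻¹` of `J`
    (J A : Submodule R Q) (hAJ : A ≤ J)
    (r : Uniserial.W → R) (hr : Uniserial.Generates r J)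
    -- `Γ_R(J/A) ≤ S̃`
    (hΓ : Uniserial.LeModClub (Uniserial.gammaSet A r) S)
    -- an `ω₁`-filtration, with `Γ'_R(J/A) = 0`
    (N : Uniserial.W → Subring R) (hN : Uniserial.IsFiltration r N)
    (hΓ' : Uniserial.EqModClub (Uniserial.gammaPrimeSet A r N) ∅)
    -- the hypothesis (&)
    (hcat : ∀ δ ∈ S, ∀ V : Set (Uniserial.Tree A r (N δ) δ), IsOpen V → V.Nonempty →
      ¬ IsMeagre (V ∩ Uniserial.convergentBranches A r (N δ) δ))
    -- a uniserial module of type `J / A`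
    (U : Type*) [AddCommGroup U] [Module R U]
    (hU : Uniserial.IsUniserial R U) (hT : Uniserial.HasType U J A) :
    Uniserial.IsStandard R Q U := by
  obtain ⟨a, ha, hcov, hae⟩ := Uniserial.exists_generators hr hU hT
  obtain ⟨E, hE, haE⟩ := Uniserial.exists_unitCocycle hr ha hae
  obtain ⟨c, hc⟩ := Uniserial.exists_coherent_units hS hR hΓ hN hΓ' hcat hE
  refine ⟨J, A, hAJ, Uniserial.nonempty_equiv_of_coherent hr (x := fun ν => c ν • a ν)
    (fun ν y => ?_) (fun u => ?_) fun σ τ hστ t ht => ?_⟩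
  · rw [smul_comm, smul_eq_zero_iff_eq, ha]
  · obtain ⟨ν, t, rfl⟩ := hcov u
    refine ⟨ν, t * ((c ν)⁻¹ : Rˣ), ?_⟩
    rw [mul_smul, ← Units.smul_def, inv_smul_smul]
  -- The difference `c σ * E σ τ - c τ` kills `a σ`, which is a unit multiple of `t • a τ`; so both
  -- coefficients act alike on `t • a τ`.
  · have h1 := (ha σ _).2 (SModEq.sub_mem.1 (hc σ τ hστ).2)
    dsimp only at h1
    have h2 : a σ = E σ τ • t • a τ := haE σ τ hστ t ht
    rw [h2, smul_comm _ (E σ τ), smul_eq_zero_iff_eq, sub_smul, sub_eq_zero, mul_comm, mul_smul,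
      ← Units.smul_def, ← Units.smul_def, ← Units.smul_def] at h1
    rw [h2, smul_comm (c σ), h1, smul_comm t (c τ)]
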